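/- An $M\times N$ binary matrix $A$ is called $(t,\epsilon)$-disjunct if at least $(1-\epsilon)\binom Nt$ of the $t$-sets $J$ of its columns have the property that the union of the supports of the columns in $J$ does not contain the support of any column outside $J$. There is a deterministic algorithm (a program of a random access machine) which, for all integers $2\le t\le N$ and all real $0<\epsilon\le 1$ (given to the algorithm as $t$, $N$ and $\lceil 1/\epsilon\rceil$), constructs in time polynomial in $N$ and $\log\frac1\epsilon$ a $(t,\epsilon)$-disjunct $M\times N$ matrix with $$M = O\Big(\frac{t}{\log t}\,\log N\,\log\frac{N}{\epsilon}\Big),$$ where the implied constant is absolute. Moreover, let $t\le N$ and $\epsilon>0$, and let the rows of a $(t,\epsilon)$-disjunct $M\times N$ matrix be used as the tests of a non-adaptive group testing scheme on $N$ items (a test is positive iff it includes a defective item). If the set of defectives is uniformly distributed among the $t$-subsets of the items, then with probability at least $1-\epsilon$ it is recovered exactly from the test results by discarding all items that are included in a negative test. -/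

import Mathlib

namespace GroupTesting

/-! ### Binary test matrices, disjunctness, group testing -/

/-- The support of the column `j` of the binary matrix `A`. -/
def support {M N : ℕ} (A : Matrix (Fin M) (Fin N) Bool) (j : Fin N) : Finset (Fin M) :=
  Finset.univ.filter fun i => A i j = true

/-- `A` is `(t, ε)`-disjunct: at least `(1 - ε) * (N choose t)` of the `t`-sets `J` of columns are
such that the union of the supports of the columns in `J` contains the support of no column
outside `J`. -/
def IsAlmostDisjunct {M N : ℕ} (A : Matrix (Fin M) (Fin N) Bool) (t : ℕ) (ε : ℝ) : Prop :=
  ∃ B : Finset (Finset (Fin N)),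
    B ⊆ Finset.powersetCard t Finset.univ ∧
    (1 - ε) * (N.choose t : ℝ) ≤ (B.card : ℝ) ∧
    ∀ J ∈ B, ∀ ν : Fin N, ν ∉ J → ¬ support A ν ⊆ J.biUnion (support A)

/-- The vector of test results when `S` is the set of defectives: a test is positive if and only if
it includes some defective item. -/
def testResult {M N : ℕ} (A : Matrix (Fin M) (Fin N) Bool) (S : Finset (Fin N)) : Fin M → Bool :=
  fun i => decide (∃ j ∈ S, A i j = true)

/-- The disjunct decoding algorithm: discard every item that is included in a negative test. -/
def decode {M N : ℕ} (A : Matrix (Fin M) (Fin N) Bool) (y : Fin M → Bool) : Finset (Fin N) :=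
  Finset.univ.filter fun j => ∀ i, y i = false → A i j = false

/-- The random model in which the set of defectives is uniform among the `t`-subsets of `N`
items. -/
noncomputable def uniformDefectives (N t : ℕ) (h : t ≤ N) : PMF (Finset (Fin N)) :=
  PMF.uniformOfFinset (Finset.powersetCard t Finset.univ)
    (Finset.powersetCard_nonempty.2 (by simpa using h))

/-! ### Random access machines with a step count

Programs work on registers `r₀, r₁, r₂, …` holding natural numbers, with indirect addressing.
The only arithmetic instructions are addition and truncated subtraction. An instruction takes one
step; since one addition lengthens numbers by at most one bit (and there is no multiplication),
running times in this model agree with those of Turing machines up to a polynomial. -/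

/-- A memory is the content of all registers. -/
abbrev Memory := ℕ → ℕ

/-- (Structured) programs of a random access machine. -/
inductive Prog : Type
  /-- do nothing -/
  | skip : Prog
  /-- `rᵢ := c` -/
  | const (i c : ℕ) : Prog
  /-- `rᵢ := rⱼ + rₖ` -/
  | add (i j k : ℕ) : Prog
  /-- `rᵢ := max (rⱼ - rₖ) 0` -/
  | sub (i j k : ℕ) : Prog
  /-- `rᵢ := r_(rⱼ)` -/
  | load (i j : ℕ) : Prog
  /-- `r_(rᵢ) := rⱼ` -/
  | store (i j : ℕ) : Prog
  /-- first `p`, then `q` -/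
  | seq (p q : Prog) : Prog
  /-- if `rᵢ ≠ 0` then `p` else `q` -/
  | ite (i : ℕ) (p q : Prog) : Prog
  /-- while `rᵢ ≠ 0` do `p` -/
  | loop (i : ℕ) (p : Prog) : Prog

/-- `Exec p σ n σ'`: the program `p`, started on the memory `σ`, halts after exactly `n` steps with
the memory `σ'`. Every instruction and every test of a register takes one step. -/
inductive Exec : Prog → Memory → ℕ → Memory → Prop
  | skip (σ : Memory) : Exec Prog.skip σ 1 σ
  | const (σ : Memory) (i c : ℕ) :
      Exec (Prog.const i c) σ 1 (Function.update σ i c)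
  | add (σ : Memory) (i j k : ℕ) :
      Exec (Prog.add i j k) σ 1 (Function.update σ i (σ j + σ k))
  | sub (σ : Memory) (i j k : ℕ) :
      Exec (Prog.sub i j k) σ 1 (Function.update σ i (σ j - σ k))
  | load (σ : Memory) (i j : ℕ) :
      Exec (Prog.load i j) σ 1 (Function.update σ i (σ (σ j)))
  | store (σ : Memory) (i j : ℕ) :
      Exec (Prog.store i j) σ 1 (Function.update σ (σ i) (σ j))
  | seq {p q : Prog} {σ σ' σ'' : Memory} {m n : ℕ} :
      Exec p σ m σ' → Exec q σ' n σ'' → Exec (Prog.seq p q) σ (m + n) σ''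
  | iteTrue {i : ℕ} {p q : Prog} {σ σ' : Memory} {n : ℕ} :
      σ i ≠ 0 → Exec p σ n σ' → Exec (Prog.ite i p q) σ (n + 1) σ'
  | iteFalse {i : ℕ} {p q : Prog} {σ σ' : Memory} {n : ℕ} :
      σ i = 0 → Exec q σ n σ' → Exec (Prog.ite i p q) σ (n + 1) σ'
  | loopDone {i : ℕ} {p : Prog} {σ : Memory} :
      σ i = 0 → Exec (Prog.loop i p) σ 1 σ
  | loopStep {i : ℕ} {p : Prog} {σ σ' σ'' : Memory} {m n : ℕ} :
      σ i ≠ 0 → Exec p σ m σ' → Exec (Prog.loop i p) σ' n σ'' →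
      Exec (Prog.loop i p) σ (m + n + 1) σ''

/-- The initial memory on the input `(a, b, c)`: these numbers in `r₀, r₁, r₂`, and `0` in all other
registers. -/
def inputMemory (a b c : ℕ) : Memory := fun i =>
  if i = 0 then a else if i = 1 then b else if i = 2 then c else 0

/-- The final memory `σ` presents the `M × N` matrix `A`: the number of rows is in `r₀`, the number
of columns in `r₁`, and `r₂` holds the address from which on the entries are listed row by row. -/
def Presents (σ : Memory) {M N : ℕ} (A : Matrix (Fin M) (Fin N) Bool) : Prop :=
  σ 0 = M ∧ σ 1 = N ∧
    ∀ (i : Fin M) (j : Fin N), σ (σ 2 + (i * N + j)) = if A i j = true then 1 else 0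

end GroupTesting

namespace GroupTesting

open Finset

/-! ### Maclaurin's inequality -/

/-! The matrix has `w` blocks of `q` rows, and block `i` encodes a labeling `c i` of the columns by
`q` labels, so every column has exactly one 1 in each block. If a `t`-set `J` covers a column `ν`
outside it, then in every block some `j ∈ J` has the label of `ν`, so the agreements of `ν` with the
members of `J` add up to at least `w` (`card_le_sum_agreement`). An exponential moment turns this
into a count: the number of such `J` times `2 ^ w` is at most the sum over `J` of the products of `2
^ agreement`, and Maclaurin's inequality bounds that sum by `N.choose t` times the `t`-th power of
the mean of `2 ^ agreement` over the columns other than `ν`. A union bound over `ν` gives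
`isAlmostDisjunct_labelMatrix`; it remains to keep all these means close to 1.

With `Q = q * N`, column `j` gets the label `⌊(g * j mod Q) / N⌋` for a multiplier `g`. Two columns
can agree only if `g` times their difference is within `N` of a multiple of `Q`, so only `N - 1`
differences have to be controlled, simultaneously for all `ν`. A fixed difference is near for at
most `5 * N` of the `Q` multipliers (`card_near_le`). Give each difference a weight that doubles
whenever it is near. Choosing the multiplier that minimizes the increase (the method of conditional
expectations) multiplies the total weight by at most `1 + 5 / q` per block (`potential_le`).

For `q = 64 * t` and `w = 2 * v` the `t`-th power of the mean is at most `2 ^ v`, so `N ≤ ε * 2 ^ v`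
suffices, and `v` can be logarithmic in `N / ε`. The resulting number of rows is `O(t * log (N /
ε))`, which implies the stated bound because `log N / log t ≥ 1`.

The greedy choice searches `Q` multipliers and `N - 1` differences in each of the `w` rounds. On the
machine it is realized by additions and truncated subtractions, and loop invariants with step bounds
establish correctness and polynomial time together. -/

theorem pow_mul_add_le_add_pow {a d : ℝ} (ha : 0 ≤ a) (had : 0 ≤ a + d) (t : ℕ) :
    a ^ t * (a + (t + 1) * d) ≤ (a + d) ^ (t + 1) := by
  rcases ha.eq_or_lt with rfl | ha
  · rcases t with _ | t
    · simp
    · simpa using pow_nonneg (by simpa using had) _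
  · have h : -2 ≤ d / a := by
      rw [le_div_iff₀ ha]; linarith
    have := mul_le_mul_of_nonneg_left (one_add_mul_le_pow h (t + 1)) (pow_nonneg ha.le (t + 1))
    rw [← mul_pow] at this
    have e : a * (1 + d / a) = a + d := by field_simp
    rw [e] at this
    refine le_trans (le_of_eq ?_) this
    push_cast
    field_simp
    ring

/-- **Maclaurin's inequality**: the mean of the `t`-fold products of nonnegative numbers is at most
the `t`-th power of their mean. -/
theorem sum_powersetCard_prod_le {ι : Type*} [DecidableEq ι] (x : ι → ℝ) (s : Finset ι)
    (hx : ∀ i ∈ s, 0 ≤ x i) (t : ℕ) :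
    ∑ J ∈ powersetCard t s, ∏ j ∈ J, x j ≤ (#s).choose t * ((∑ j ∈ s, x j) / #s) ^ t := by
  induction s using Finset.induction_on generalizing t with
  | empty =>
    rcases t with _ | t
    · simp
    · rw [powersetCard_eq_empty.2 (by simp : #(∅ : Finset ι) < t + 1)]
      simp
  | insert a s has ih =>
    rcases t with _ | t
    · simp
    have hs : ∀ i ∈ s, 0 ≤ x i := fun i hi => hx i (mem_insert_of_mem hi)
    have hb : 0 ≤ x a := hx a (mem_insert_self _ _)
    have hsplit : ∑ J ∈ powersetCard (t + 1) (insert a s), ∏ j ∈ J, x j =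
        ∑ J ∈ powersetCard (t + 1) s, ∏ j ∈ J, x j +
          x a * ∑ J ∈ powersetCard t s, ∏ j ∈ J, x j := by
      rw [powersetCard_succ_insert has, sum_union, sum_image, mul_sum]
      · congr 1
        refine sum_congr rfl fun J hJ => prod_insert fun h => has ?_
        exact (mem_powersetCard.1 hJ).1 h
      · intro J hJ K hK h
        have hJ' : a ∉ J := fun h => has ((mem_powersetCard.1 hJ).1 h)
        have hK' : a ∉ K := fun h => has ((mem_powersetCard.1 hK).1 h)
        rw [← erase_insert hJ', h, erase_insert hK']
      · rw [disjoint_left]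
        rintro J hJ hJ'
        obtain ⟨K, -, rfl⟩ := mem_image.1 hJ'
        exact has ((mem_powersetCard.1 hJ).1 (mem_insert_self _ _))
    have hS : 0 ≤ ∑ j ∈ s, x j := sum_nonneg hs
    set n := #s with hn
    set α := (∑ j ∈ s, x j) / n with hα
    have hα0 : 0 ≤ α := by positivity
    -- For empty `s` the mean is `0 / 0 = 0`, and the identity still holds.
    have hnα : ∑ j ∈ s, x j = n * α := by
      rcases Nat.eq_zero_or_pos n with h | h
      · have : s = ∅ := card_eq_zero.1 (hn.symm.trans h)
        rw [h, this, sum_empty, Nat.cast_zero, zero_mul]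
      · rw [hα, mul_div_cancel₀ _ (by positivity)]
    rw [hsplit, card_insert_of_notMem has, sum_insert has, hnα, ← hn]
    -- With `d = (x a - α) / (n + 1)`, inserting `a` moves the mean from `α` to `α + d`, and the two
    -- inductive bounds add up to exactly `(n + 1).choose (t + 1) * α ^ t * (α + (t + 1) * d)`.
    -- Bernoulli's inequality in the form `pow_mul_add_le_add_pow` then finishes.
    have h1 := ih hs (t + 1)
    have h2 := mul_le_mul_of_nonneg_left (ih hs t) hb
    refine (add_le_add h1 h2).trans ?_
    have c1 : ((n + 1 : ℕ) : ℝ) * n.choose t = (n + 1).choose (t + 1) * ((t + 1 : ℕ) : ℝ) := by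
      exact_mod_cast Nat.add_one_mul_choose_eq n t
    have c2 : ((n + 1).choose (t + 1) : ℝ) = n.choose t + n.choose (t + 1) := by
      exact_mod_cast Nat.choose_succ_succ n t
    have hpos : (0 : ℝ) < n + 1 := Nat.cast_add_one_pos n
    clear_value α n
    have e : (x a + n * α) / ((n + 1 : ℕ) : ℝ) = α + (x a - α) / (n + 1) := by
      push_cast; field_simp; ring
    have hd : 0 ≤ α + (x a - α) / (n + 1) := by
      rw [← e]
      exact div_nonneg (by positivity) (by positivity)
    rw [e]
    refine le_trans (le_of_eq ?_) (mul_le_mul_of_nonneg_left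
      (pow_mul_add_le_add_pow hα0 hd t) (Nat.cast_nonneg _))
    have c3 : (n.choose t : ℝ) = (n + 1).choose (t + 1) * (t + 1) / (n + 1) := by
      rw [eq_div_iff hpos.ne']; push_cast at c1; linarith
    have c4 : (n.choose (t + 1) : ℝ) = (n + 1).choose (t + 1) - n.choose t := by linarith
    rw [c4, c3]
    ring

/-! ### Almost disjunct matrices from labelings -/

/-- The number of the first `w` labelings `c 0, c 1, …` that agree on `j` and `ν`. -/
def agreement {N : ℕ} (c : ℕ → Fin N → ℕ) (w : ℕ) (ν j : Fin N) : ℕ :=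
  #{i ∈ range w | c i j = c i ν}

/-- The matrix whose row `i * q + y` is the indicator of the set of columns with label `y` under the
labeling `c i`. -/
def labelMatrix {N : ℕ} (c : ℕ → Fin N → ℕ) (w q : ℕ) : Matrix (Fin (w * q)) (Fin N) Bool :=
  fun r j => decide (c (r / q) j = r % q)

/-- In block `i` the only 1 of column `ν` is in row `i * q + c i ν`; a column of `J` that covers it
has the same label. -/
theorem card_le_sum_agreement {N : ℕ} (c : ℕ → Fin N → ℕ) {w q : ℕ} (hc : ∀ i j, c i j < q)
    {J : Finset (Fin N)} {ν : Fin N}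
    (h : support (labelMatrix c w q) ν ⊆ J.biUnion (support (labelMatrix c w q))) :
    w ≤ ∑ j ∈ J, agreement c w ν j := by
  have key : range w ⊆ J.biUnion fun j => {i ∈ range w | c i j = c i ν} := by
    intro i hi
    have hi' : i < w := mem_range.1 hi
    have hq : 0 < q := (Nat.zero_le _).trans_lt (hc i ν)
    have hlt : i * q + c i ν < w * q := by
      calc i * q + c i ν < i * q + q := by simpa using hc i ν
        _ = (i + 1) * q := by ring
        _ ≤ w * q := Nat.mul_le_mul_right _ hi'
    have hdiv : (i * q + c i ν) / q = i := by
      rw [mul_comm, Nat.mul_add_div hq, Nat.div_eq_of_lt (hc i ν), add_zero]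
    have hmod : (i * q + c i ν) % q = c i ν := by
      rw [Nat.mul_add_mod', Nat.mod_eq_of_lt (hc i ν)]
    have hν : (⟨i * q + c i ν, hlt⟩ : Fin (w * q)) ∈ support (labelMatrix c w q) ν := by
      simp [support, labelMatrix, hdiv, hmod]
    obtain ⟨j, hj, hj'⟩ := mem_biUnion.1 (h hν)
    simp only [support, labelMatrix, mem_filter, mem_univ, true_and, decide_eq_true_eq, hdiv,
      hmod] at hj'
    exact mem_biUnion.2 ⟨j, hj, mem_filter.2 ⟨hi, hj'⟩⟩
  calc w = #(range w) := (card_range w).symm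
    _ ≤ _ := card_le_card key
    _ ≤ _ := card_biUnion_le

/-- If the averages of `2 ^ agreement` around each column are small, then the label matrix is
almost disjunct. -/
theorem isAlmostDisjunct_labelMatrix {N : ℕ} (c : ℕ → Fin N → ℕ) {w q t : ℕ}
    (hc : ∀ i j, c i j < q) {ε R : ℝ}
    (hR : ∀ ν, ∑ j ∈ univ.erase ν, (2 : ℝ) ^ agreement c w ν j ≤ ((N - 1 : ℕ) : ℝ) * R)
    (hR0 : 0 ≤ R) (hε : N * R ^ t ≤ ε * 2 ^ w) :
    IsAlmostDisjunct (labelMatrix c w q) t ε := by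
  classical
  set A := labelMatrix c w q
  let bad : Fin N → Finset (Finset (Fin N)) := fun ν =>
    {J ∈ powersetCard t (univ.erase ν) | support A ν ⊆ J.biUnion (support A)}
  have hbad : ∀ ν, (#(bad ν) : ℝ) * 2 ^ w ≤ N.choose t * R ^ t := by
    intro ν
    have hcard : #(univ.erase ν) = N - 1 := by simp
    calc (#(bad ν) : ℝ) * 2 ^ w = ∑ J ∈ bad ν, (2 : ℝ) ^ w := by simp
      _ ≤ ∑ J ∈ bad ν, ∏ j ∈ J, (2 : ℝ) ^ agreement c w ν j := by
          refine sum_le_sum fun J hJ => ?_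
          rw [prod_pow_eq_pow_sum]
          exact pow_le_pow_right₀ (by norm_num)
            (card_le_sum_agreement c hc (mem_filter.1 hJ).2)
      _ ≤ ∑ J ∈ powersetCard t (univ.erase ν), ∏ j ∈ J, (2 : ℝ) ^ agreement c w ν j :=
          sum_le_sum_of_subset_of_nonneg (filter_subset _ _) fun _ _ _ =>
            prod_nonneg fun _ _ => by positivity
      _ ≤ _ := sum_powersetCard_prod_le _ _ (fun _ _ => by positivity) t
      _ ≤ (N - 1).choose t * R ^ t := by
          rw [hcard]
          refine mul_le_mul_of_nonneg_left (pow_le_pow_left₀ ?_ ?_ t) (Nat.cast_nonneg _)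
          · exact div_nonneg (sum_nonneg fun _ _ => by positivity) (Nat.cast_nonneg _)
          · rcases Nat.eq_zero_or_pos (N - 1) with h | h
            · simp [h, hR0]
            · rw [div_le_iff₀ (by exact_mod_cast h), mul_comm]
              exact hR ν
      _ ≤ _ := by
          gcongr
          omega
  refine ⟨{J ∈ powersetCard t (univ : Finset (Fin N)) |
      ∀ ν, ν ∉ J → ¬ support A ν ⊆ J.biUnion (support A)},
    filter_subset _ _, ?_, fun J hJ => (mem_filter.1 hJ).2⟩
  -- A `t`-set that fails is bad for some `ν` outside it, hence is a subset of `univ.erase ν`: this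
  -- is the union bound.
  have hcover : powersetCard t (univ : Finset (Fin N)) ⊆
      ({J ∈ powersetCard t (univ : Finset (Fin N)) |
        ∀ ν, ν ∉ J → ¬ support A ν ⊆ J.biUnion (support A)}) ∪
        univ.biUnion bad := by
    intro J hJ
    rw [mem_union, mem_filter]
    by_cases h : ∀ ν, ν ∉ J → ¬ support A ν ⊆ J.biUnion (support A)
    · exact Or.inl ⟨hJ, h⟩
    · push Not at h
      obtain ⟨ν, hν, hs⟩ := h
      refine Or.inr (mem_biUnion.2 ⟨ν, mem_univ _, mem_filter.2 ⟨mem_powersetCard.2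
        ⟨fun j hj => mem_erase.2 ⟨?_, mem_univ _⟩, (mem_powersetCard.1 hJ).2⟩, hs⟩⟩)
      rintro rfl
      exact hν hj
  have h1 : (N.choose t : ℝ) ≤ #({J ∈ powersetCard t (univ : Finset (Fin N)) |
      ∀ ν, ν ∉ J → ¬ support A ν ⊆ J.biUnion (support A)}) + ∑ ν, (#(bad ν) : ℝ) := by
    have := (card_le_card hcover).trans ((card_union_le _ _).trans
      (Nat.add_le_add_left card_biUnion_le _))
    rw [card_powersetCard, card_univ, Fintype.card_fin] at this
    exact_mod_cast this
  have h2 : (∑ ν, (#(bad ν) : ℝ)) * 2 ^ w ≤ ε * N.choose t * 2 ^ w := by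
    calc (∑ ν, (#(bad ν) : ℝ)) * 2 ^ w = ∑ ν, (#(bad ν) : ℝ) * 2 ^ w := sum_mul _ _ _
      _ ≤ ∑ _ν : Fin N, (N.choose t : ℝ) * R ^ t := sum_le_sum fun ν _ => hbad ν
      _ = N.choose t * (N * R ^ t) := by simp; ring
      _ ≤ N.choose t * (ε * 2 ^ w) := by gcongr
      _ = _ := by ring
  have h3 := le_of_mul_le_mul_right h2 (by positivity)
  linarith

/-! ### Modular labelings -/

/-- Differences `m` for which `g * m` is within distance `N` of a multiple of `Q`. -/
def Near (N Q g m : ℕ) : Prop := (N + g * m) % Q < 2 * N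

instance (N Q g m : ℕ) : Decidable (Near N Q g m) := inferInstanceAs (Decidable (_ < _))

/-- Residues with the same quotient by `N` differ by less than `N`, so `g * d` is congruent to a
number strictly between `-N` and `N`. The shift by `N` in `Near` keeps everything in the natural
numbers. -/
theorem near_of_label_eq {N Q g a d : ℕ} (hQ : 2 * N ≤ Q) (hN : 0 < N)
    (h : (g * (a + d)) % Q / N = (g * a) % Q / N) : Near N Q g d := by
  unfold Near
  set x := (g * a) % Q
  set y := (g * (a + d)) % Q
  have hx : x < Q := Nat.mod_lt _ (by omega)
  have hy : y < Q := Nat.mod_lt _ (by omega)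
  have e1 := Nat.div_add_mod x N
  have e2 := Nat.div_add_mod y N
  have l1 := Nat.mod_lt x hN
  have l2 := Nat.mod_lt y hN
  rw [h] at e2
  have hmod : (N + g * d + x) ≡ (N + y) [MOD Q] := by
    have h1 : (N + g * d + x) ≡ (N + g * d + g * a) [MOD Q] :=
      Nat.ModEq.add_left _ (Nat.mod_modEq _ _)
    have h2 : N + g * d + g * a = N + g * (a + d) := by ring
    rw [h2] at h1
    exact h1.trans (Nat.ModEq.add_left _ (Nat.mod_modEq _ _).symm)
  have h3 : N + y = (N + y - x) + x := by omega
  rw [h3] at hmod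
  have h4 := Nat.ModEq.add_right_cancel' x hmod
  have h5 : (N + g * d) % Q = N + y - x := by
    rw [h4, Nat.mod_eq_of_lt (by omega)]
  omega

/-- The values `g * m` have gaps of at least `m`, so a window of length `L` meets at most `L / m +
1` of them. -/
theorem card_le_div_add_one {m b L : ℕ} (hm : 0 < m) (N : ℕ) (s : Finset ℕ)
    (h : ∀ g ∈ s, b ≤ N + g * m ∧ N + g * m < b + L) : #s ≤ L / m + 1 := by
  rcases s.eq_empty_or_nonempty with rfl | hs
  · simp
  have hsub : s ⊆ Icc (s.min' hs) (s.min' hs + L / m) := by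
    intro g hg
    have h0 := s.min'_le g hg
    obtain ⟨d, hd⟩ := Nat.exists_eq_add_of_le h0
    rw [mem_Icc]
    refine ⟨h0, ?_⟩
    have h1 := (h _ (s.min'_mem hs)).1
    have h2 := (h g hg).2
    rw [hd, add_mul] at h2
    have : d ≤ L / m := (Nat.le_div_iff_mul_le hm).2 (by omega)
    omega
  refine (card_le_card hsub).trans ?_
  simp
  omega

/-- For `g < Q` the number `N + g * m` lies below `(m + 1) * Q`, so only `m + 1` windows of length
`2 * N` matter. The product `(m + 1) * (2 * N / m + 1)` is at most `2 * N + 2 * N + (m + 1)`, and `m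
+ 1 ≤ N`. -/
theorem card_near_le {N q m : ℕ} (hm : 0 < m) (hmN : m < N) :
    #{g ∈ range (q * N) | Near N (q * N) g m} ≤ 5 * N := by
  rcases Nat.eq_zero_or_pos q with rfl | hq
  · simp
  set Q := q * N with hQ
  have hQN : N ≤ Q := Nat.le_mul_of_pos_left _ hq
  have hsub : {g ∈ range Q | Near N Q g m} ⊆ (range (m + 1)).biUnion fun k =>
      {g ∈ range Q | k * Q ≤ N + g * m ∧ N + g * m < k * Q + 2 * N} := by
    intro g hg
    obtain ⟨hg, hn⟩ := mem_filter.1 hg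
    have hgQ := mem_range.1 hg
    have e := Nat.div_add_mod (N + g * m) Q
    unfold Near at hn
    refine mem_biUnion.2 ⟨(N + g * m) / Q, mem_range.2 ?_, mem_filter.2 ⟨hg, ?_⟩⟩
    · rw [Nat.div_lt_iff_lt_mul (by omega)]
      obtain ⟨d, hd⟩ := Nat.exists_eq_add_of_lt hgQ
      rw [hd] at hQN ⊢
      nlinarith
    · rw [mul_comm]
      omega
  have h1 : 2 * N / m * m ≤ 2 * N := Nat.div_mul_le_self _ _
  have h2 : 2 * N / m ≤ 2 * N := Nat.div_le_self _ _
  calc _ ≤ _ := card_le_card hsub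
    _ ≤ ∑ k ∈ range (m + 1), (2 * N / m + 1) := card_biUnion_le.trans
        (sum_le_sum fun k _ => card_le_div_add_one hm N _ fun g hg => (mem_filter.1 hg).2)
    _ = (m + 1) * (2 * N / m + 1) := by simp
    _ ≤ 5 * N := by nlinarith

/-! ### The greedy choice of multipliers -/

/-- The first minimizer of `S` below `k`. -/
def argMin (S : ℕ → ℕ) : ℕ → ℕ
  | 0 => 0
  | k + 1 => if S k < S (argMin S k) then k else argMin S k

theorem argMin_le (S : ℕ → ℕ) {k g : ℕ} (h : g < k) : S (argMin S k) ≤ S g := by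
  induction k with
  | zero => omega
  | succ k ih =>
    rcases Nat.lt_succ_iff_lt_or_eq.1 h with h | rfl
    · have := ih h
      simp only [argMin]
      split_ifs with h' <;> omega
    · simp only [argMin]
      split_ifs with h' <;> omega

/-- The total weight of the near differences. -/
def nearWeight (N Q : ℕ) (W : ℕ → ℕ) (g : ℕ) : ℕ :=
  ∑ k ∈ range (N - 1), if Near N Q g (k + 1) then W (k + 1) else 0

/-- The weight of a difference, doubled by each greedily chosen multiplier that is near it. -/
def weight (N Q : ℕ) : ℕ → ℕ → ℕ
  | 0 => fun _ => 1
  | i + 1 => fun m =>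
    if Near N Q (argMin (nearWeight N Q (weight N Q i)) Q) m then 2 * weight N Q i m
    else weight N Q i m

/-- The `i`-th greedily chosen multiplier. -/
def multiplier (N Q i : ℕ) : ℕ := argMin (nearWeight N Q (weight N Q i)) Q

theorem weight_succ (N Q i m : ℕ) :
    weight N Q (i + 1) m =
      if Near N Q (multiplier N Q i) m then 2 * weight N Q i m else weight N Q i m := rfl

/-- The sum of the weights of all differences. -/
def potential (N Q i : ℕ) : ℕ := ∑ k ∈ range (N - 1), weight N Q i (k + 1)

theorem potential_succ (N Q i : ℕ) :
    potential N Q (i + 1) =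
      potential N Q i + nearWeight N Q (weight N Q i) (multiplier N Q i) := by
  unfold potential nearWeight
  rw [← sum_add_distrib]
  refine sum_congr rfl fun k _ => ?_
  rw [weight_succ]
  split_ifs <;> omega

/-- The minimum over the `q * N` multipliers is at most the average. Exchanging the sums, each
difference contributes its weight for at most `5 * N` multipliers. -/
theorem mul_nearWeight_multiplier_le {N : ℕ} (hN : 0 < N) (q i : ℕ) :
    q * nearWeight N (q * N) (weight N (q * N) i) (multiplier N (q * N) i) ≤
      5 * potential N (q * N) i := by
  set Q := q * N with hQ
  set S := nearWeight N Q (weight N Q i)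
  have h1 : Q * S (multiplier N Q i) ≤ ∑ g ∈ range Q, S g := by
    have := card_nsmul_le_sum (range Q) S (S (multiplier N Q i))
      fun g hg => argMin_le S (mem_range.1 hg)
    simpa using this
  have h2 : ∑ g ∈ range Q, S g ≤ 5 * N * potential N Q i := by
    simp only [S, nearWeight, potential]
    rw [sum_comm, mul_sum]
    refine sum_le_sum fun k hk => ?_
    rw [← sum_filter, sum_const, smul_eq_mul]
    have := mem_range.1 hk
    exact Nat.mul_le_mul_right _ (card_near_le (by omega) (by omega))
  refine le_of_mul_le_mul_left (a := N) ?_ hN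
  calc N * (q * S (multiplier N Q i)) = Q * S (multiplier N Q i) := by rw [hQ]; ring
    _ ≤ _ := h1.trans h2
    _ = _ := by ring

theorem potential_le {N q : ℕ} (hN : 0 < N) (hq : 0 < q) (i : ℕ) :
    (potential N (q * N) i : ℝ) ≤ ((N - 1 : ℕ) : ℝ) * (1 + 5 / q) ^ i := by
  induction i with
  | zero => simp [potential, weight]
  | succ i ih =>
    have h : (q : ℝ) * nearWeight N (q * N) (weight N (q * N) i) (multiplier N (q * N) i) ≤
        5 * potential N (q * N) i := by exact_mod_cast mul_nearWeight_multiplier_le hN q i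
    rw [potential_succ]
    push_cast
    have hq' : (0 : ℝ) < q := by exact_mod_cast hq
    calc _ ≤ (potential N (q * N) i : ℝ) + 5 * potential N (q * N) i / q := by
          gcongr
          rw [le_div_iff₀ hq']; linarith
      _ = potential N (q * N) i * (1 + 5 / q) := by ring
      _ ≤ _ := by
          rw [pow_succ, ← mul_assoc]
          gcongr

theorem weight_eq (N Q w m : ℕ) :
    weight N Q w m = 2 ^ #{i ∈ range w | Near N Q (multiplier N Q i) m} := by
  induction w with
  | zero => simp [weight]
  | succ w ih =>
    rw [weight_succ, ih, range_add_one, filter_insert]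
    split_ifs with h
    · rw [card_insert_of_notMem (by simp), pow_succ]; ring
    · rfl

/-- The labeling of the columns by the greedily chosen multipliers. -/
def greedyLabel (N Q i : ℕ) (j : Fin N) : ℕ := multiplier N Q i * j % Q / N

theorem greedyLabel_lt {N q : ℕ} (hq : 0 < q) (i : ℕ) (j : Fin N) :
    greedyLabel N (q * N) i j < q := by
  have hN : 0 < N := (Nat.zero_le _).trans_lt j.2
  rw [greedyLabel, Nat.div_lt_iff_lt_mul hN]
  exact Nat.mod_lt _ (Nat.mul_pos hq hN)

theorem two_pow_agreement_le {N q : ℕ} (hq : 2 ≤ q) (w : ℕ) {ν j : Fin N} {m : ℕ}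
    (h : (j : ℕ) = ν + m ∨ (ν : ℕ) = j + m) :
    2 ^ agreement (greedyLabel N (q * N)) w ν j ≤ weight N (q * N) w m := by
  have hN : 0 < N := (Nat.zero_le _).trans_lt j.2
  have hQ : 2 * N ≤ q * N := Nat.mul_le_mul_right _ hq
  rw [weight_eq]
  refine Nat.pow_le_pow_right (by norm_num) (card_le_card fun i hi => ?_)
  obtain ⟨hi, he⟩ := mem_filter.1 hi
  refine mem_filter.2 ⟨hi, ?_⟩
  rcases h with h | h
  · rw [greedyLabel, greedyLabel, h] at he
    exact near_of_label_eq hQ hN he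
  · rw [greedyLabel, greedyLabel, h] at he
    exact near_of_label_eq hQ hN he.symm

/-- Each difference occurs at most once to the left of `ν` and at most once to the right. The excess
over 1 is what gets doubled, not the weight itself: with `u = (1 + 5 / q) ^ w` the mean is at most
`1 + 2 * (u - 1) ≤ u ^ 2`, whereas the cruder bound `2 * u` would cost a factor `2 ^ t` after taking
the `t`-th power. -/
theorem sum_two_pow_agreement_le {N q : ℕ} (hq : 2 ≤ q) (w : ℕ) (ν : Fin N) :
    ∑ j ∈ univ.erase ν, (2 : ℝ) ^ agreement (greedyLabel N (q * N)) w ν j ≤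
      ((N - 1 : ℕ) : ℝ) * ((1 + 5 / q) ^ w) ^ 2 := by
  have hN : 0 < N := (Nat.zero_le _).trans_lt ν.2
  set a := fun j => agreement (greedyLabel N (q * N)) w ν j with ha
  set f : ℕ → ℝ := fun m => (weight N (q * N) w m : ℝ) - 1 with hf
  have hf0 : ∀ m, 0 ≤ f m := fun m => by
    have : 1 ≤ weight N (q * N) w m := by rw [weight_eq]; exact Nat.one_le_two_pow
    simp only [hf, sub_nonneg]
    exact_mod_cast this
  have hle : ∀ (j : Fin N) (m : ℕ), ((j : ℕ) = ν + m ∨ (ν : ℕ) = j + m) →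
      (2 : ℝ) ^ a j - 1 ≤ f m := fun j m h => by
    have := two_pow_agreement_le hq w h
    simp only [hf, ha]
    have h' : (2 : ℝ) ^ agreement (greedyLabel N (q * N)) w ν j ≤ weight N (q * N) w m := by
      exact_mod_cast this
    linarith
  have hF : ∑ m ∈ range (N - 1), f (m + 1) =
      (potential N (q * N) w : ℝ) - ((N - 1 : ℕ) : ℝ) := by
    simp [hf, potential]
  have hlt : ∑ j ∈ univ.filter (· < ν), ((2 : ℝ) ^ a j - 1) ≤ ∑ m ∈ range (N - 1), f (m + 1) := by
    calc _ ≤ ∑ j ∈ univ.filter (· < ν), f ((ν - j - 1 : ℕ) + 1) := by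
          refine sum_le_sum fun j hj => hle _ _ (Or.inr ?_)
          have : (j : ℕ) < ν := (mem_filter.1 hj).2
          omega
      _ = ∑ m ∈ (univ.filter (· < ν)).image (fun j : Fin N => (ν - j - 1 : ℕ)), f (m + 1) := by
          rw [sum_image]
          intro j hj k hk h
          have h1 : (j : ℕ) < ν := (mem_filter.1 hj).2
          have h2 : (k : ℕ) < ν := (mem_filter.1 hk).2
          ext
          simp only at h
          omega
      _ ≤ _ := by
          refine sum_le_sum_of_subset_of_nonneg (fun m hm => ?_) fun m _ _ => hf0 _
          obtain ⟨j, hj, rfl⟩ := mem_image.1 hm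
          have h1 : (j : ℕ) < ν := (mem_filter.1 hj).2
          rw [mem_range]
          omega
  have hgt : ∑ j ∈ univ.filter (ν < ·), ((2 : ℝ) ^ a j - 1) ≤ ∑ m ∈ range (N - 1), f (m + 1) := by
    calc _ ≤ ∑ j ∈ univ.filter (ν < ·), f ((j - ν - 1 : ℕ) + 1) := by
          refine sum_le_sum fun j hj => hle _ _ (Or.inl ?_)
          have : (ν : ℕ) < j := (mem_filter.1 hj).2
          omega
      _ = ∑ m ∈ (univ.filter (ν < ·)).image (fun j : Fin N => (j - ν - 1 : ℕ)), f (m + 1) := by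
          rw [sum_image]
          intro j hj k hk h
          have h1 : (ν : ℕ) < j := (mem_filter.1 hj).2
          have h2 : (ν : ℕ) < k := (mem_filter.1 hk).2
          ext
          simp only at h
          omega
      _ ≤ _ := by
          refine sum_le_sum_of_subset_of_nonneg (fun m hm => ?_) fun m _ _ => hf0 _
          obtain ⟨j, hj, rfl⟩ := mem_image.1 hm
          have h1 : (ν : ℕ) < j := (mem_filter.1 hj).2
          rw [mem_range]
          omega
  have hsplit : (univ.erase ν : Finset (Fin N)) = univ.filter (· < ν) ∪ univ.filter (ν < ·) := by
    ext j
    simp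
  have hsum : ∑ j ∈ univ.erase ν, ((2 : ℝ) ^ a j - 1) ≤
      2 * ((potential N (q * N) w : ℝ) - ((N - 1 : ℕ) : ℝ)) := by
    rw [hsplit, sum_union, ← hF]
    · linarith
    · rw [disjoint_filter]
      exact fun j _ h => h.not_gt
  rw [sum_sub_distrib, sum_const, card_erase_of_mem (mem_univ _), card_univ, Fintype.card_fin,
    nsmul_eq_mul, mul_one] at hsum
  have hp := potential_le hN (by omega : 0 < q) w
  set u : ℝ := (1 + 5 / q) ^ w
  have : (0 : ℝ) ≤ ((N - 1 : ℕ) : ℝ) := Nat.cast_nonneg _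
  -- This is `2 * u - 1 ≤ u ^ 2`.
  nlinarith [mul_nonneg this (sq_nonneg (u - 1))]

theorem isAlmostDisjunct_greedy {N t v : ℕ} (ht : 0 < t) {ε : ℝ} (h : N ≤ ε * 2 ^ v) :
    IsAlmostDisjunct (labelMatrix (greedyLabel N (64 * t * N)) (2 * v) (64 * t)) t ε := by
  refine isAlmostDisjunct_labelMatrix _ (greedyLabel_lt (by omega))
    (sum_two_pow_agreement_le (by omega) _) (by positivity) ?_
  have ht' : (0 : ℝ) < t := by exact_mod_cast ht
  -- The exponent is `2 * t` per block, and there are two blocks for each unit of `v`.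
  have h1 : (1 + 5 / ((64 * t : ℕ) : ℝ)) ^ (4 * t) ≤ 2 := by
    calc _ ≤ (Real.exp (5 / ((64 * t : ℕ) : ℝ))) ^ (4 * t) := by
          refine pow_le_pow_left₀ (by positivity) ?_ _
          rw [add_comm]
          exact Real.add_one_le_exp _
      _ = Real.exp (5 / 16) := by
          rw [← Real.exp_nat_mul]
          congr 1
          push_cast
          field_simp
          norm_num
      _ ≤ 2 := by
          have := Real.add_one_le_exp (-(5 / 16) : ℝ)
          rw [Real.exp_neg] at this
          have hp := Real.exp_pos (5 / 16)
          rw [le_inv_comm₀ (by norm_num) hp] at this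
          exact this.trans (by norm_num)
  have h2 : (((1 + 5 / ((64 * t : ℕ) : ℝ)) ^ (2 * v)) ^ 2) ^ t ≤ 2 ^ v := by
    calc _ = ((1 + 5 / ((64 * t : ℕ) : ℝ)) ^ (4 * t)) ^ v := by
          rw [← pow_mul, ← pow_mul, ← pow_mul]; congr 1; ring
      _ ≤ 2 ^ v := pow_le_pow_left₀ (by positivity) h1 v
  have h3 : 0 ≤ ε * 2 ^ v := (Nat.cast_nonneg N).trans h
  calc _ ≤ (ε * 2 ^ v) * 2 ^ v := by gcongr
    _ = _ := by rw [mul_assoc, ← pow_add, two_mul]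

/-! ### Reasoning about programs -/

/-- The program `p` halts on `σ` after at most `T` steps, in a memory satisfying `Post`. -/
def Runs (p : Prog) (σ : Memory) (T : ℕ) (Post : Memory → Prop) : Prop :=
  ∃ n σ', Exec p σ n σ' ∧ n ≤ T ∧ Post σ'

/-- The sequential composition of a list of programs. -/
def block : List Prog → Prog
  | [] => Prog.skip
  | p :: l => Prog.seq p (block l)

/-- The memory computed by a program without loops. -/
def result : Prog → Memory → Memory
  | .skip, σ => σ
  | .const i c, σ => Function.update σ i c
  | .add i j k, σ => Function.update σ i (σ j + σ k)
  | .sub i j k, σ => Function.update σ i (σ j - σ k)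
  | .load i j, σ => Function.update σ i (σ (σ j))
  | .store i j, σ => Function.update σ (σ i) (σ j)
  | .seq p q, σ => result q (result p σ)
  | .ite i p q, σ => if σ i = 0 then result q σ else result p σ
  | .loop _ _, σ => σ

/-- A bound for the number of steps of a program without loops. -/
def cost : Prog → ℕ
  | .seq p q => cost p + cost q
  | .ite _ p q => cost p + cost q + 1
  | _ => 1

/-- Whether a program has no loops. -/
def loopFree : Prog → Bool
  | .seq p q => loopFree p && loopFree q
  | .ite _ p q => loopFree p && loopFree q
  | .loop _ _ => false
  | _ => true

theorem exec_of_loopFree (p : Prog) (hp : loopFree p = true) (σ : Memory) :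
    ∃ n, Exec p σ n (result p σ) ∧ n ≤ cost p := by
  induction p generalizing σ with
  | skip => exact ⟨_, .skip σ, le_rfl⟩
  | const i c => exact ⟨_, .const σ i c, le_rfl⟩
  | add i j k => exact ⟨_, .add σ i j k, le_rfl⟩
  | sub i j k => exact ⟨_, .sub σ i j k, le_rfl⟩
  | load i j => exact ⟨_, .load σ i j, le_rfl⟩
  | store i j => exact ⟨_, .store σ i j, le_rfl⟩
  | seq p q ihp ihq =>
    rw [loopFree, Bool.and_eq_true] at hp
    obtain ⟨m, hm, hm'⟩ := ihp hp.1 σ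
    obtain ⟨n, hn, hn'⟩ := ihq hp.2 (result p σ)
    exact ⟨_, .seq hm hn, Nat.add_le_add hm' hn'⟩
  | ite i p q ihp ihq =>
    rw [loopFree, Bool.and_eq_true] at hp
    by_cases h : σ i = 0
    · obtain ⟨n, hn, hn'⟩ := ihq hp.2 σ
      refine ⟨_, .iteFalse h (by rwa [result, if_pos h]), ?_⟩
      rw [cost]; omega
    · obtain ⟨n, hn, hn'⟩ := ihp hp.1 σ
      refine ⟨_, .iteTrue h (by rwa [result, if_neg h]), ?_⟩
      rw [cost]; omega
  | loop i p ih => simp [loopFree] at hp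

theorem Runs.of_loopFree {p : Prog} {σ : Memory} {T : ℕ} {Post : Memory → Prop}
    (hp : loopFree p = true) (hT : cost p ≤ T) (h : Post (result p σ)) : Runs p σ T Post := by
  obtain ⟨n, hn, hn'⟩ := exec_of_loopFree p hp σ
  exact ⟨n, _, hn, hn'.trans hT, h⟩

theorem Runs.mono {p : Prog} {σ : Memory} {T T' : ℕ} {Post Post' : Memory → Prop}
    (h : Runs p σ T Post) (hT : T ≤ T') (hP : ∀ σ', Post σ' → Post' σ') : Runs p σ T' Post' := by
  obtain ⟨n, σ', h1, h2, h3⟩ := h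
  exact ⟨n, σ', h1, h2.trans hT, hP _ h3⟩

theorem Runs.seq {p q : Prog} {σ : Memory} {S T : ℕ} {Mid Post : Memory → Prop}
    (hp : Runs p σ S Mid) (hq : ∀ σ', Mid σ' → Runs q σ' T Post) :
    Runs (.seq p q) σ (S + T) Post := by
  obtain ⟨m, σ', h1, h2, h3⟩ := hp
  obtain ⟨n, σ'', h4, h5, h6⟩ := hq σ' h3
  exact ⟨_, σ'', .seq h1 h4, Nat.add_le_add h2 h5, h6⟩

/-- The invariant is indexed by the round, so termination after exactly `K` rounds and the time
bound come with correctness; the extra steps are the tests of the control register. -/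
theorem Runs.loop {i : ℕ} {p : Prog} {T K : ℕ} (Inv : ℕ → Memory → Prop)
    (hstep : ∀ k < K, ∀ σ, Inv k σ → σ i ≠ 0 ∧ Runs p σ T (Inv (k + 1)))
    (hend : ∀ σ, Inv K σ → σ i = 0) {σ : Memory} (h0 : Inv 0 σ) :
    Runs (.loop i p) σ (K * (T + 1) + 1) (Inv K) := by
  suffices H : ∀ d k σ, k + d = K → Inv k σ → Runs (.loop i p) σ (d * (T + 1) + 1) (Inv K) from
    H K 0 σ (zero_add K) h0
  intro d
  induction d with
  | zero =>
    rintro k σ rfl hk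
    exact ⟨1, σ, .loopDone (hend σ hk), by omega, hk⟩
  | succ d ih =>
    intro k σ hd hk
    obtain ⟨hne, m, σ', h1, h2, h3⟩ := hstep k (by omega) σ hk
    obtain ⟨n, σ'', h4, h5, h6⟩ := ih (k + 1) σ' (by omega) h3
    refine ⟨_, σ'', .loopStep hne h1 h4, ?_, h6⟩
    rw [add_mul]
    omega

/-- A loop whose control register counts down from `K`. -/
theorem Runs.count {i : ℕ} {p : Prog} {T K : ℕ} (Inv : ℕ → Memory → Prop)
    (hstep : ∀ k < K, ∀ σ, σ i = K - k → Inv k σ →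
      Runs p σ T (fun σ' => σ' i = K - (k + 1) ∧ Inv (k + 1) σ'))
    {σ : Memory} (hi : σ i = K) (h0 : Inv 0 σ) :
    Runs (.loop i p) σ (K * (T + 1) + 1) (Inv K) := by
  refine (Runs.loop (fun k σ => σ i = K - k ∧ Inv k σ) (fun k hk σ h => ⟨?_, hstep k hk σ h.1 h.2⟩)
    (fun σ h => by rw [h.1, Nat.sub_self]) ⟨hi, h0⟩).mono le_rfl fun _ h => h.2
  rw [h.1]
  omega

/-- The registers below `n` and from `32` on are unchanged. -/
def Frame (n : ℕ) (σ σ' : Memory) : Prop := ∀ a, a < n ∨ 32 ≤ a → σ' a = σ a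

theorem Frame.refl (n : ℕ) (σ : Memory) : Frame n σ σ := fun _ _ => rfl

theorem Frame.trans {n m : ℕ} {σ σ' σ'' : Memory} (h : Frame n σ σ') (h' : Frame m σ' σ'')
    (hnm : n ≤ m) : Frame n σ σ'' := fun a ha =>
  (h' a (by omega)).trans (h a ha)

theorem frame_update_iff {n i v : ℕ} {σ σ' : Memory} (h : n ≤ i) (h' : i < 32) :
    Frame n σ (Function.update σ' i v) ↔ Frame n σ σ' := by
  refine forall₂_congr fun a ha => ?_
  rw [Function.update_of_ne (by omega)]

/-- The registers below `n` are unchanged. -/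
def RegFrame (n : ℕ) (σ σ' : Memory) : Prop := ∀ a < n, σ' a = σ a

theorem RegFrame.refl (n : ℕ) (σ : Memory) : RegFrame n σ σ := fun _ _ => rfl

theorem RegFrame.trans {n m : ℕ} {σ σ' σ'' : Memory} (h : RegFrame n σ σ') (h' : RegFrame m σ' σ'')
    (hnm : n ≤ m) : RegFrame n σ σ'' := fun a ha =>
  (h' a (by omega)).trans (h a ha)

theorem Frame.regFrame {n : ℕ} {σ σ' : Memory} (h : Frame n σ σ') : RegFrame n σ σ' :=
  fun a ha => h a (Or.inl ha)

theorem regFrame_update_iff {n i v : ℕ} {σ σ' : Memory} (h : n ≤ i) :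
    RegFrame n σ (Function.update σ' i v) ↔ RegFrame n σ σ' := by
  refine forall₂_congr fun a ha => ?_
  rw [Function.update_of_ne (by omega)]

/-- The registers that hold constants in the main part of the program. -/
structure Consts (M N Q : ℕ) (σ : Memory) : Prop where
  rows : σ 0 = M
  cols : σ 1 = N
  base : σ 2 = N + 32
  one : σ 3 = 1
  twice : σ 4 = 2 * N
  modulus : σ 5 = Q
  heap : σ 6 = 32
  zero : σ 7 = 0

theorem Consts.of_regFrame {M N Q n : ℕ} {σ σ' : Memory} (h : Consts M N Q σ)
    (h' : RegFrame n σ σ') (hn : 8 ≤ n) : Consts M N Q σ' :=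
  ⟨(h' 0 (by omega)).trans h.1, (h' 1 (by omega)).trans h.2, (h' 2 (by omega)).trans h.3,
    (h' 3 (by omega)).trans h.4, (h' 4 (by omega)).trans h.5, (h' 5 (by omega)).trans h.6,
    (h' 6 (by omega)).trans h.7, (h' 7 (by omega)).trans h.8⟩

/-- The weights are stored from address `32` on. -/
def StoresWeights (N : ℕ) (W : ℕ → ℕ) (σ : Memory) : Prop :=
  ∀ m, 0 < m → m < N → σ (m + 32) = W m

/-- The entries of the matrix are stored from address `N + 32` on. -/
def StoresEntries (N : ℕ) (f : ℕ → ℕ) (σ : Memory) : Prop :=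
  ∀ x, σ (x + N + 32) = f x

theorem StoresWeights.of_frame {N n : ℕ} {W : ℕ → ℕ} {σ σ' : Memory} (h : StoresWeights N W σ)
    (h' : Frame n σ σ') : StoresWeights N W σ' := fun m h0 hm =>
  (h' _ (by omega)).trans (h m h0 hm)

theorem StoresEntries.of_frame {N n : ℕ} {f : ℕ → ℕ} {σ σ' : Memory} (h : StoresEntries N f σ)
    (h' : Frame n σ σ') : StoresEntries N f σ' := fun x =>
  (h' _ (by omega)).trans (h x)

/-! ### The program -/

open Prog

/-- Add `r₁₄` to `r₁₈` modulo `r₅`. -/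
def addMod : Prog := block [add 18 18 14, add 21 18 3, sub 21 21 5, ite 21 (sub 18 18 5) skip]

theorem result_addMod {σ : Memory} {y g Q : ℕ} (hy : σ 18 = y % Q) (hg : σ 14 = g) (h3 : σ 3 = 1)
    (hQ : σ 5 = Q) (hgQ : g < Q) :
    ∃ z, result addMod σ = Function.update (Function.update σ 18 ((y + g) % Q)) 21 z := by
  have hyQ : y % Q < Q := Nat.mod_lt _ (by omega)
  have hmod : (y + g) % Q = if y % Q + g < Q then y % Q + g else y % Q + g - Q := by
    rw [Nat.add_mod, Nat.mod_eq_of_lt hgQ]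
    split_ifs with h
    · exact Nat.mod_eq_of_lt h
    · rw [Nat.mod_eq_sub_mod (by omega), Nat.mod_eq_of_lt (by omega)]
  -- Truncated subtraction serves as the comparison: this number is nonzero exactly if the sum has
  -- reached `Q`. Both summands are below `Q`, so one subtraction of `Q` reduces it.
  refine ⟨y % Q + g + 1 - Q, ?_⟩
  rw [hmod]
  simp only [addMod, block, result, Function.update_self, Function.update_of_ne, ne_eq,
    Nat.reduceEqDiff, not_false_eq_true, hy, hg, h3, hQ]
  funext a
  by_cases h : y % Q + g < Q
  · have : y % Q + g + 1 - Q = 0 := by omega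
    simp [this, h, Function.update_apply]
    grind
  · have : y % Q + g + 1 - Q ≠ 0 := by omega
    simp [this, h, Function.update_apply]
    grind

/-- Go to the next difference and add its weight to `r₁₇` if it is near. -/
def sumStep : Prog :=
  block [add 19 19 3, addMod, sub 21 4 18, ite 21 (block [load 21 19, add 17 17 21]) skip,
    sub 20 20 3]

theorem runs_sumLoop {M N Q g : ℕ} {W : ℕ → ℕ} {σ : Memory} (hσ : Consts M N Q σ)
    (hW : StoresWeights N W σ) (hg : σ 14 = g) (hgQ : g < Q) (hNQ : N < Q) (h17 : σ 17 = 0)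
    (h18 : σ 18 = N) (h19 : σ 19 = 32) (h20 : σ 20 = N - 1) :
    Runs (loop 20 sumStep) σ ((N - 1) * (30 + 1) + 1)
      (fun σ' => Frame 17 σ σ' ∧ σ' 17 = nearWeight N Q W g) := by
  -- Starting `r₁₈` at `N` makes it run through the shifted residues in `Near`, so that `2 * N -
  -- r₁₈` is nonzero exactly for near differences.
  refine (Runs.count (fun k σ' => Frame 17 σ σ' ∧ σ' 18 = (N + g * k) % Q ∧ σ' 19 = k + 32 ∧
    σ' 17 = ∑ l ∈ range k, if Near N Q g (l + 1) then W (l + 1) else 0) ?_ h20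
    ⟨.refl _ _, by simp [h18, Nat.mod_eq_of_lt hNQ], by simp [h19], by simp [h17]⟩).mono le_rfl
    fun σ' h => ⟨h.1, h.2.2.2⟩
  rintro k hk τ hτ ⟨hf, h18, h19, h17⟩
  have hc := hσ.of_regFrame hf.regFrame (by norm_num)
  have hw := hW.of_frame hf (k + 1) (by omega) (by omega)
  have hg' : τ 14 = g := (hf 14 (by norm_num)).trans hg
  refine .of_loopFree rfl (by decide) ?_
  have e : N + g * k + g = N + g * (k + 1) := by ring
  obtain ⟨z, hz⟩ := result_addMod (σ := Function.update τ 19 (k + 1 + 32)) (y := N + g * k)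
    (g := g) (Q := Q) (by simpa) (by simpa) (by simpa using hc.one) (by simpa using hc.modulus) hgQ
  rw [e] at hz
  have hk1 : k + 32 + 1 = k + 1 + 32 := by ring
  rw [Finset.sum_range_succ]
  by_cases hn : Near N Q g (k + 1)
  · have : 2 * N - (N + g * (k + 1)) % Q ≠ 0 := by unfold Near at hn; omega
    simp [sumStep, block, result, h19, hc.one, hz, hk1, this, hc.twice, h17, hn, hτ,
      frame_update_iff, hf, hw]
    omega
  · have : 2 * N - (N + g * (k + 1)) % Q = 0 := by unfold Near at hn; omega
    simp [sumStep, block, result, h19, hc.one, hz, hk1, this, hc.twice, h17, hn, hτ,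
      frame_update_iff, hf]
    omega

/-- Go to the next difference and double its weight if it is near. -/
def doubleStep : Prog :=
  block [add 19 19 3, addMod, sub 21 4 18,
    ite 21 (block [load 21 19, add 21 21 21, store 19 21]) skip, sub 20 20 3]

theorem runs_doubleLoop {M N Q g : ℕ} {W f : ℕ → ℕ} {σ : Memory} (hσ : Consts M N Q σ)
    (hW : StoresWeights N W σ) (hf : StoresEntries N f σ) (hg : σ 14 = g) (hgQ : g < Q)
    (hNQ : N < Q) (h18 : σ 18 = N) (h19 : σ 19 = 32) (h20 : σ 20 = N - 1) :
    Runs (loop 20 doubleStep) σ ((N - 1) * (30 + 1) + 1)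
      (fun σ' => RegFrame 17 σ σ' ∧
        StoresWeights N (fun m => if Near N Q g m then 2 * W m else W m) σ' ∧
        StoresEntries N f σ') := by
  refine (Runs.count (fun k σ' => RegFrame 17 σ σ' ∧ σ' 18 = (N + g * k) % Q ∧ σ' 19 = k + 32 ∧
    StoresWeights N (fun m => if m ≤ k ∧ Near N Q g m then 2 * W m else W m) σ' ∧
    StoresEntries N f σ') ?_ h20
    ⟨.refl _ _, by simp [h18, Nat.mod_eq_of_lt hNQ], by simp [h19], ?_, hf⟩).mono le_rfl
    fun σ' h => ⟨h.1, ?_, h.2.2.2.2⟩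
  rotate_left
  · intro m h0 hm
    have : ¬ m ≤ 0 := by omega
    simp [hW m h0 hm, this]
  · intro m h0 hm
    rw [h.2.2.2.1 m h0 hm]
    have : m ≤ N - 1 := by omega
    simp [this]
  rintro k hk τ hτ ⟨hr, h18, h19, hw, hf⟩
  have hc := hσ.of_regFrame hr (by norm_num)
  have hg' : τ 14 = g := (hr 14 (by norm_num)).trans hg
  have hwk : τ (k + 1 + 32) = W (k + 1) := by
    have := hw (k + 1) (by omega) (by omega)
    simpa using this
  refine .of_loopFree rfl (by decide) ?_
  have e : N + g * k + g = N + g * (k + 1) := by ring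
  obtain ⟨z, hz⟩ := result_addMod (σ := Function.update τ 19 (k + 1 + 32)) (y := N + g * k)
    (g := g) (Q := Q) (by simpa) (by simpa) (by simpa using hc.one) (by simpa using hc.modulus) hgQ
  rw [e] at hz
  have hk1 : k + 32 + 1 = k + 1 + 32 := by ring
  by_cases hn : Near N Q g (k + 1)
  · have : 2 * N - (N + g * (k + 1)) % Q ≠ 0 := by unfold Near at hn; omega
    refine ⟨?_, ?_, ?_, ?_, ?_, ?_⟩
    · simp [block, doubleStep, result, h19, hc.one, hz, hk1, this, hc.twice, hτ]
      omega
    · simp [block, doubleStep, result, h19, hc.one, hz, hk1, this, hc.twice, regFrame_update_iff,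
        hr]
    · simp [block, doubleStep, result, h19, hc.one, hz, hk1, this, hc.twice]
    · simp [block, doubleStep, result, h19, hc.one, hz, hk1, this, hc.twice]
    · intro m h0 hm
      by_cases hmk : m = k + 1
      · subst hmk
        simp [block, doubleStep, result, h19, hc.one, hz, hk1, this, hc.twice, hwk, hn]
        omega
      · have hm' := hw m h0 hm
        have hle : m ≤ k + 1 ↔ m ≤ k := by omega
        simp [block, doubleStep, result, h19, hc.one, hz, hk1, this, hc.twice,
          hmk, hm', hle]
    · intro x
      have hx : x + N ≠ k + 1 := by omega
      simp [block, doubleStep, result, h19, hc.one, hz, hk1, this, hc.twice,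
        hx, hf x]
  · have : 2 * N - (N + g * (k + 1)) % Q = 0 := by unfold Near at hn; omega
    refine ⟨?_, ?_, ?_, ?_, ?_, ?_⟩
    · simp [block, doubleStep, result, h19, hc.one, hz, hk1, this, hc.twice, hτ]
      omega
    · simp [block, doubleStep, result, h19, hc.one, hz, hk1, this, hc.twice, regFrame_update_iff,
        hr]
    · simp [block, doubleStep, result, h19, hc.one, hz, hk1, this, hc.twice]
    · simp [block, doubleStep, result, h19, hc.one, hz, hk1, this, hc.twice]
    · intro m h0 hm
      have hle : m ≤ k + 1 ∧ Near N Q g m ↔ m ≤ k ∧ Near N Q g m := by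
        refine ⟨fun h => ⟨?_, h.2⟩, fun h => ⟨by omega, h.2⟩⟩
        rcases Nat.lt_or_ge k m with h1 | h1
        · exact absurd ((by omega : m = k + 1) ▸ h.2) hn
        · exact h1
      simp [block, doubleStep, result, h19, hc.one, hz, hk1, this, hc.twice,
        hw m h0 hm, hle]
    · intro x
      simp [block, doubleStep, result, h19, hc.one, hz, hk1, this, hc.twice,
        hf x]

/-! ### Searching the greedy multiplier -/

/-- Find the first multiplier that minimizes the total weight of the near differences. -/
def selectLoop : Prog :=
  loop 13 (block [const 17 0, add 18 1 7, add 19 6 7, sub 20 1 3, loop 20 sumStep,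
    sub 21 11 17, ite 21 (block [add 11 17 7, add 12 14 7]) skip, add 14 14 3, sub 13 13 3])

theorem Runs.step {p q : Prog} {σ : Memory} {S T : ℕ} {Post : Memory → Prop}
    (hp : loopFree p = true) (hS : cost p ≤ S) (hq : Runs q (result p σ) T Post) :
    Runs (.seq p q) σ (S + T) Post :=
  Runs.seq (Mid := fun σ' => σ' = result p σ) (.of_loopFree hp hS rfl) fun _ h => h ▸ hq

/-- Every difference is near for the multiplier 0, so the search can start from candidate 0 with the
current potential as its value. -/
theorem nearWeight_zero {N Q : ℕ} (W : ℕ → ℕ) (hNQ : N < Q) (hN : 0 < N) :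
    nearWeight N Q W 0 = ∑ k ∈ range (N - 1), W (k + 1) := by
  refine sum_congr rfl fun k _ => if_pos ?_
  unfold Near
  rw [zero_mul, add_zero, Nat.mod_eq_of_lt hNQ]
  omega

theorem runs_selectLoop {M N Q : ℕ} {W : ℕ → ℕ} {σ : Memory} (hσ : Consts M N Q σ)
    (hW : StoresWeights N W σ) (hNQ : N < Q) (h11 : σ 11 = nearWeight N Q W 0)
    (h12 : σ 12 = 0) (h13 : σ 13 = Q) (h14 : σ 14 = 0) :
    Runs selectLoop σ (Q * ((31 * N + 100) + 1) + 1)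
      (fun σ' => Frame 11 σ σ' ∧ σ' 12 = argMin (nearWeight N Q W) Q ∧
        σ' 11 = nearWeight N Q W (argMin (nearWeight N Q W) Q)) := by
  refine (Runs.count (fun k σ' => Frame 11 σ σ' ∧ σ' 12 = argMin (nearWeight N Q W) k ∧
    σ' 11 = nearWeight N Q W (argMin (nearWeight N Q W) k) ∧ σ' 14 = k) ?_ h13
    ⟨.refl _ _, h12, h11, h14⟩).mono le_rfl fun σ' h => ⟨h.1, h.2.1, h.2.2.1⟩
  rintro k hk τ hτ ⟨hf, h12, h11, h14⟩
  have hc := hσ.of_regFrame hf.regFrame (by norm_num)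
  have hw := hW.of_frame hf
  set τ' : Memory := Function.update (Function.update (Function.update (Function.update τ 17 0)
    18 N) 19 32) 20 (N - 1) with hτ'
  have hf' : Frame 17 τ τ' := by simp [hτ', frame_update_iff, Frame.refl]
  have H := runs_sumLoop (hc.of_regFrame hf'.regFrame (by norm_num)) (hw.of_frame hf')
    ((hf' 14 (by norm_num)).trans h14) hk hNQ (by simp [hτ']) (by simp [hτ']) (by simp [hτ'])
    (by simp [hτ'])
  refine Runs.mono (T := 1 + (1 + (1 + (1 + (((N - 1) * (30 + 1) + 1) + 20))))) ?_ (by omega)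
    fun _ h => h
  refine .step rfl le_rfl (.step rfl le_rfl (.step rfl le_rfl (.step rfl le_rfl ?_)))
  have hstart : result (sub 20 1 3) (result (add 19 6 7) (result (add 18 1 7)
      (result (const 17 0) τ))) = τ' := by
    simp [result, hc.one, hc.cols, hc.heap, hc.zero, hτ']
  rw [hstart]
  refine H.seq ?_
  rintro ρ ⟨hρ, h17⟩
  have hρ' := hf'.trans hρ le_rfl
  refine .of_loopFree rfl (by decide) ?_
  have hcρ := hc.of_regFrame hρ'.regFrame (by norm_num)
  have r11 := (hρ' 11 (by norm_num)).trans h11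
  have r12 := (hρ' 12 (by norm_num)).trans h12
  have r13 := (hρ' 13 (by norm_num)).trans hτ
  have r14 := (hρ' 14 (by norm_num)).trans h14
  have hfr := hf.trans hρ' (by norm_num)
  by_cases hlt : nearWeight N Q W k < nearWeight N Q W (argMin (nearWeight N Q W) k)
  · have : nearWeight N Q W (argMin (nearWeight N Q W) k) - nearWeight N Q W k ≠ 0 := by omega
    have ha : argMin (nearWeight N Q W) (k + 1) = k := by rw [argMin, if_pos hlt]
    simp [block, result, r11, r13, r14, h17, this, frame_update_iff, hfr, ha, hcρ.one,
      hcρ.zero]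
    omega
  · have : nearWeight N Q W (argMin (nearWeight N Q W) k) - nearWeight N Q W k = 0 := by omega
    have ha : argMin (nearWeight N Q W) (k + 1) = argMin (nearWeight N Q W) k := by
      rw [argMin, if_neg hlt]
    simp [block, result, r11, r12, r13, r14, h17, this, frame_update_iff, hfr, ha, hcρ.one]
    omega

/-! ### Writing one block of rows -/

/-- Move `r₂₄` by the largest multiple of `r₁` that is at most `r₁₈`. -/
def divLoop : Prog := loop 21 (block [sub 23 23 1, add 24 24 1, add 21 23 3, sub 21 21 1])

theorem runs_divLoop {N v a : ℕ} {σ : Memory} (hN : 0 < N) (h1 : σ 1 = N) (h3 : σ 3 = 1)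
    (h21 : σ 21 = v + 1 - N) (h23 : σ 23 = v) (h24 : σ 24 = a) :
    Runs divLoop σ (v / N * (10 + 1) + 1) (fun σ' =>
      Frame 21 σ σ' ∧ σ' 24 = a + v / N * N) := by
  -- Rows have length `N`, so each subtraction of `N` from the residue moves the address one row
  -- down: the label selects the row with neither division nor multiplication.
  refine (Runs.loop (fun k σ' => Frame 21 σ σ' ∧ σ' 24 = a + k * N ∧ σ' 23 = v - k * N ∧
    σ' 21 = v - k * N + 1 - N) ?_ ?_ ⟨.refl _ _, by simpa, by simpa, by simpa⟩).mono le_rfl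
    fun σ' h => ⟨h.1, h.2.1⟩
  · rintro k hk τ ⟨hf, h24, h23, h21⟩
    have hle : (k + 1) * N ≤ v := (Nat.le_div_iff_mul_le hN).1 hk
    have e : (k + 1) * N = k * N + N := by ring
    have t1 := (hf 1 (by norm_num)).trans h1
    have t3 := (hf 3 (by norm_num)).trans h3
    refine ⟨by omega, .of_loopFree rfl (by decide) ?_⟩
    simp [block, result, t1, t3, h23, h24, frame_update_iff, hf]
    omega
  · rintro τ ⟨-, -, -, h21⟩
    have e := Nat.div_add_mod' v N
    have := Nat.mod_lt v hN
    omega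

/-- Write the entry `1` of the next column of the current block of rows. -/
def writeStep : Prog :=
  block [add 23 18 7, add 24 19 7, add 21 18 3, sub 21 21 1, divLoop, store 24 3, add 19 19 3,
    addMod, sub 20 20 3]

/-- The entries of the label matrix, listed row by row. -/
def entry (N Q x : ℕ) : ℕ :=
  if multiplier N Q (x / Q) * (x % N) % Q / N = x % Q / N then 1 else 0

/-- The part of the entries in the first `i` blocks and in the first `j` columns of the next
block. -/
def partialEntry (N Q i j x : ℕ) : ℕ :=
  if x < i * Q ∨ (x < (i + 1) * Q ∧ x % N < j) then entry N Q x else 0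

/-- A block occupies `Q` consecutive cells, and within it a column has a single 1, in the row given
by its label. Since untouched memory is 0, one store completes the column. -/
theorem partialEntry_succ {N q i j : ℕ} (hq : 0 < q) (hj : j < N) (x : ℕ) :
    partialEntry N (q * N) i (j + 1) x =
      if x = i * (q * N) + j + multiplier N (q * N) i * j % (q * N) / N * N then 1
      else partialEntry N (q * N) i j x := by
  set Q := q * N with hQ
  set v := multiplier N Q i * j % Q with hv
  have hN : 0 < N := by omega
  have hQpos : 0 < Q := Nat.mul_pos hq hN
  have hvQ : v < Q := Nat.mod_lt _ hQpos
  have hdvd : N ∣ Q := Dvd.intro_left q rfl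
  have hvN : v / N * N + j < Q := by
    have : v / N < q := (Nat.div_lt_iff_lt_mul hN).2 hvQ
    calc v / N * N + j < v / N * N + N := by omega
      _ = (v / N + 1) * N := by ring
      _ ≤ Q := Nat.mul_le_mul_right _ this
  have e1 : (i + 1) * Q = i * Q + Q := by ring
  by_cases hx : i * Q ≤ x ∧ x < (i + 1) * Q ∧ x % N = j
  · obtain ⟨h1, h2, h3⟩ := hx
    obtain ⟨z, rfl⟩ := Nat.exists_eq_add_of_le h1
    have hz : z < Q := by omega
    have hzN : z % N = j := by
      rw [← h3, hQ, ← mul_assoc, Nat.mul_add_mod']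
    have hzdiv : (i * Q + z) / Q = i := by
      rw [mul_comm, Nat.mul_add_div hQpos, Nat.div_eq_of_lt hz, add_zero]
    have hzmod : (i * Q + z) % Q = z := by
      rw [Nat.mul_add_mod', Nat.mod_eq_of_lt hz]
    have hp : partialEntry N Q i j (i * Q + z) = 0 := by
      rw [partialEntry, if_neg]
      omega
    have hp' : partialEntry N Q i (j + 1) (i * Q + z) = entry N Q (i * Q + z) := by
      rw [partialEntry, if_pos]
      omega
    rw [hp, hp', entry, hzdiv, hzmod, h3, ← hv]
    have e2 := Nat.div_add_mod' z N
    congr 1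
    refine propext ⟨fun h => by rw [h]; omega, fun h => ?_⟩
    have : v / N * N = z / N * N := by omega
    exact Nat.eq_of_mul_eq_mul_right hN this
  · rw [if_neg]
    · unfold partialEntry
      congr 1
      refine propext ?_
      omega
    · rintro rfl
      refine hx ⟨by omega, by omega, ?_⟩
      rw [hQ, ← mul_assoc, add_right_comm, ← add_mul, Nat.mul_add_mod', Nat.mod_eq_of_lt hj]

theorem partialEntry_all {N Q i : ℕ} (hN : 0 < N) (x : ℕ) :
    partialEntry N Q i N x = partialEntry N Q (i + 1) 0 x := by
  unfold partialEntry
  have := Nat.mod_lt x hN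
  have e1 : (i + 1) * Q = i * Q + Q := by ring
  congr 1
  refine propext ?_
  omega

theorem runs_writeLoop {M N q i : ℕ} {σ : Memory} (hσ : Consts M N (q * N) σ) (hN : 0 < N)
    (hg : σ 14 = multiplier N (q * N) i) (hgQ : multiplier N (q * N) i < q * N)
    {W : ℕ → ℕ} (hW : StoresWeights N W σ)
    (hf : StoresEntries N (partialEntry N (q * N) i 0) σ)
    (h18 : σ 18 = 0) (h19 : σ 19 = i * (q * N) + N + 32) (h20 : σ 20 = N) :
    Runs (loop 20 writeStep) σ (N * ((11 * q + 100) + 1) + 1)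
      (fun σ' => RegFrame 17 σ σ' ∧ StoresWeights N W σ' ∧
        StoresEntries N (partialEntry N (q * N) (i + 1) 0) σ') := by
  set Q := q * N with hQ
  set g := multiplier N Q i with hg0
  refine (Runs.count (fun j σ' => RegFrame 17 σ σ' ∧ StoresWeights N W σ' ∧
    StoresEntries N (partialEntry N Q i j) σ' ∧ σ' 18 = g * j % Q ∧
    σ' 19 = i * Q + j + N + 32) ?_ h20
    ⟨.refl _ _, hW, hf, by simpa, by simpa⟩).mono le_rfl
    fun σ' h => ⟨h.1, h.2.1, fun x => (h.2.2.1 x).trans (partialEntry_all hN x)⟩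
  rintro j hj τ hτ ⟨hr, hw, hf, h18, h19⟩
  have hc := hσ.of_regFrame hr (by norm_num)
  have hg' : τ 14 = g := (hr 14 (by norm_num)).trans hg
  set v := g * j % Q with hv
  have hvq : v / N < q := (Nat.div_lt_iff_lt_mul hN).2 (Nat.mod_lt _ (by omega))
  refine Runs.mono (T := 1 + (1 + (1 + (1 + ((v / N * (10 + 1) + 1) + 50))))) ?_ (by omega)
    fun _ h => h
  refine .step rfl le_rfl (.step rfl le_rfl (.step rfl le_rfl (.step rfl le_rfl ?_)))
  set τ' := result (sub 21 21 1) (result (add 21 18 3) (result (add 24 19 7)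
      (result (add 23 18 7) τ))) with hτ'
  have hf' : Frame 21 τ τ' := by simp [hτ', result, frame_update_iff, Frame.refl]
  have H := runs_divLoop (σ := τ') (v := v) (a := i * Q + j + N + 32) hN
    ((hf' 1 (by norm_num)).trans hc.cols)
    ((hf' 3 (by norm_num)).trans hc.one) (by simp [hτ', result, h18, hc.one, hc.cols])
    (by simp [hτ', result, h18, hc.zero]) (by simp [hτ', result, h19, hc.zero])
  refine H.seq ?_
  rintro ρ ⟨hρ, h24⟩
  have hρ' := hf'.trans hρ le_rfl
  refine .of_loopFree rfl (by decide) ?_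
  have hcρ := hc.of_regFrame hρ'.regFrame (by norm_num)
  have r18 := (hρ' 18 (by norm_num)).trans h18
  have r19 := (hρ' 19 (by norm_num)).trans h19
  have r20 := (hρ' 20 (by norm_num)).trans hτ
  have r14 := (hρ' 14 (by norm_num)).trans hg'
  have hwρ := hw.of_frame hρ'
  have hfρ := hf.of_frame hρ'
  have hrρ := hr.trans (hρ'.regFrame) (by norm_num)
  set A := i * Q + j + v / N * N with hA
  have hA' : i * Q + j + N + 32 + v / N * N = A + N + 32 := by rw [hA]; ring
  rw [hA'] at h24
  set ρ' := Function.update (Function.update ρ (A + N + 32) 1) 19 (i * Q + (j + 1) + N + 32)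
    with hρ0
  have c1 := hcρ.one
  obtain ⟨z, hz⟩ := result_addMod (σ := ρ') (y := g * j)
    (g := g) (Q := Q) (by simp [hρ0, r18, hv]) (by simp [hρ0, r14]) (by simp [hρ0, hcρ.one])
    (by simp [hρ0, hcρ.modulus]) hgQ
  have hstart : result (add 19 19 3) (result (store 24 3) ρ) = ρ' := by
    simp only [result, h24, c1, hρ0]
    simp [r19, c1]
    congr 1
    omega
  simp only [block, result.eq_7]
  rw [hstart, hz]
  refine ⟨?_, ?_, ?_, ?_, ?_, ?_⟩
  · simp [result, hρ0, r20, c1]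
    omega
  · simp [result, hρ0, regFrame_update_iff, hrρ]
  · intro m h0 hm
    have h1 := hwρ m h0 hm
    have h2 : m ≠ A + N := by omega
    simp [result, hρ0, h1, h2]
  · intro x
    have h1 := hfρ x
    rw [hQ, partialEntry_succ ((Nat.zero_le _).trans_lt hvq) hj, ← hQ, ← hg0, ← hv, ← hA]
    simp [result, hρ0, Function.update_apply, h1]
  · simp [result, hρ0]
    ring_nf
  · simp [result, hρ0]

/-! ### The main loop -/

/-- For each block of rows, choose a multiplier, update the weights and write the block. -/
def mainLoop : Prog :=
  loop 8 (block [add 11 10 7, const 12 0, add 13 5 7, const 14 0, selectLoop,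
    add 14 12 7, add 18 1 7, add 19 6 7, sub 20 1 3, add 10 10 11, loop 20 doubleStep,
    const 18 0, add 19 9 7, add 20 1 7, loop 20 writeStep, add 9 9 5, sub 8 8 3])

/-- A bound for the number of steps of one round of the main loop. -/
def roundTime (N q : ℕ) : ℕ := q * N * (31 * N + 101) + 31 * N + N * (11 * q + 101) + 60

theorem round_le_roundTime (N q : ℕ) :
    1 + (1 + (1 + (1 + ((q * N * ((31 * N + 100) + 1) + 1) + (1 + (1 + (1 + (1 + (1 +
      (((N - 1) * (30 + 1) + 1) + (1 + (1 + (1 + ((N * ((11 * q + 100) + 1) + 1) + 10))))))))))))))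
      ≤ roundTime N q := by
  have : (N - 1) * (30 + 1) ≤ N * 31 := Nat.mul_le_mul_right _ (Nat.sub_le _ _)
  unfold roundTime
  linarith

theorem argMin_lt (S : ℕ → ℕ) {k : ℕ} (hk : 0 < k) : argMin S k < k := by
  induction k with
  | zero => omega
  | succ k ih =>
    rw [argMin]
    split_ifs
    · omega
    · rcases Nat.eq_zero_or_pos k with rfl | h
      · simp [argMin]
      · have := ih h
        omega

theorem runs_mainLoop {M N q w : ℕ} {σ : Memory} (hσ : Consts M N (q * N) σ) (hN : 0 < N)
    (hq : 2 ≤ q) (h8 : σ 8 = w) (h9 : σ 9 = N + 32) (h10 : σ 10 = N - 1)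
    (hW : StoresWeights N (fun _ => 1) σ) (hf : StoresEntries N (fun _ => 0) σ) :
    Runs mainLoop σ (w * (roundTime N q + 1) + 1)
      (fun σ' => RegFrame 8 σ σ' ∧ StoresEntries N (partialEntry N (q * N) w 0) σ') := by
  set Q := q * N with hQ
  have hNQ : N < Q := by nlinarith
  have h0 : partialEntry N Q 0 0 = fun _ => 0 := by
    funext x
    simp [partialEntry]
  -- `r₉` is the address of the next block. `r₁₀` carries the potential, updated by adding the
  -- minimum just found.
  refine (Runs.count (fun i σ' => RegFrame 8 σ σ' ∧ σ' 9 = i * Q + N + 32 ∧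
    σ' 10 = potential N Q i ∧ StoresWeights N (weight N Q i) σ' ∧
    StoresEntries N (partialEntry N Q i 0) σ') ?_ h8
    ⟨.refl _ _, by simpa, by simp [h10, potential, weight], hW, h0 ▸ hf⟩).mono le_rfl
    fun σ' h => ⟨h.1, h.2.2.2.2⟩
  rintro i - τ hτ ⟨hr, h9, h10, hw, hf⟩
  have hc := hσ.of_regFrame hr le_rfl
  set W := weight N Q i
  set g := multiplier N Q i with hg
  have hgQ : g < Q := argMin_lt _ (by omega)
  refine Runs.mono (T := 1 + (1 + (1 + (1 + ((Q * ((31 * N + 100) + 1) + 1) + (1 + (1 + (1 + (1 + (1 +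
    (((N - 1) * (30 + 1) + 1) + (1 + (1 + (1 + ((N * ((11 * q + 100) + 1) + 1) + 10)))))))))))))))
    ?_ (round_le_roundTime N q) fun _ h => h
  refine .step rfl le_rfl (.step rfl le_rfl (.step rfl le_rfl (.step rfl le_rfl ?_)))
  set τ₁ := result (const 14 0) (result (add 13 5 7) (result (const 12 0)
    (result (add 11 10 7) τ))) with hτ₁
  have f₁ : Frame 11 τ τ₁ := by simp [hτ₁, result, frame_update_iff, Frame.refl]
  refine (runs_selectLoop (hc.of_regFrame f₁.regFrame (by norm_num)) (hw.of_frame f₁) hNQ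
    (by rw [nearWeight_zero _ hNQ hN]; simp [hτ₁, result, h10, hc.zero, potential, W])
    (by simp [hτ₁, result]) (by simp [hτ₁, result, hc.modulus, hc.zero])
    (by simp [hτ₁, result])).seq ?_
  rintro τ₂ ⟨f₂, s12, s11⟩
  change τ₂ 12 = g at s12
  change τ₂ 11 = nearWeight N Q W g at s11
  replace f₂ := f₁.trans f₂ le_rfl
  have hc₂ := hc.of_regFrame f₂.regFrame (by norm_num)
  have s10 := (f₂ 10 (by norm_num)).trans h10
  refine .step rfl le_rfl (.step rfl le_rfl (.step rfl le_rfl (.step rfl le_rfl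
    (.step rfl le_rfl ?_))))
  set τ₃ := result (add 10 10 11) (result (sub 20 1 3) (result (add 19 6 7)
    (result (add 18 1 7) (result (add 14 12 7) τ₂)))) with hτ₃
  have f₃ : Frame 10 τ₂ τ₃ := by simp [hτ₃, result, frame_update_iff, Frame.refl]
  have u10 : τ₃ 10 = potential N Q (i + 1) := by
    rw [potential_succ]
    simp [hτ₃, result, s10, s11, W, hg]
  have u14 : τ₃ 14 = g := by simp [hτ₃, result, s12, hc₂.zero]
  have hc₃ := hc₂.of_regFrame f₃.regFrame (by norm_num)
  refine (runs_doubleLoop hc₃ ((hw.of_frame f₂).of_frame f₃) ((hf.of_frame f₂).of_frame f₃)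
    u14 hgQ hNQ (by simp [hτ₃, result, hc₂.cols, hc₂.zero])
    (by simp [hτ₃, result, hc₂.heap, hc₂.zero])
    (by simp [hτ₃, result, hc₂.cols, hc₂.one])).seq ?_
  rintro τ₄ ⟨f₄, hw₄, hf₄⟩
  have hc₄ := hc₃.of_regFrame f₄ (by norm_num)
  have v9 : τ₄ 9 = i * Q + N + 32 :=
    (f₄ 9 (by norm_num)).trans ((f₃ 9 (by norm_num)).trans ((f₂ 9 (by norm_num)).trans h9))
  refine .step rfl le_rfl (.step rfl le_rfl (.step rfl le_rfl ?_))
  set τ₅ := result (add 20 1 7) (result (add 19 9 7) (result (const 18 0) τ₄)) with hτ₅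
  have f₅ : Frame 17 τ₄ τ₅ := by simp [hτ₅, result, frame_update_iff, Frame.refl]
  refine (runs_writeLoop (hc₄.of_regFrame f₅.regFrame (by norm_num)) hN
    ((f₅ 14 (by norm_num)).trans ((f₄ 14 (by norm_num)).trans u14)) hgQ
    (hw₄.of_frame f₅) (hf₄.of_frame f₅) (by simp [hτ₅, result])
    (by simp [hτ₅, result, v9, hc₄.zero, hQ]) (by simp [hτ₅, result, hc₄.cols, hc₄.zero])).seq ?_
  rintro τ₆ ⟨f₆, hw₆, hf₆⟩
  have f₇ : RegFrame 17 τ₃ τ₆ := (f₄.trans f₅.regFrame le_rfl).trans f₆ le_rfl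
  have f₈ : RegFrame 10 τ τ₆ :=
    
    (f₃.regFrame.trans f₇ (by norm_num) : RegFrame 10 τ₂ τ₆) |> fun h a ha =>
      (h a ha).trans (f₂ a (by omega))
  have hc₆ := hc.of_regFrame f₈ (by norm_num)
  have x8 := (f₈ 8 (by norm_num)).trans hτ
  have x9 := (f₈ 9 (by norm_num)).trans h9
  have x10 := (f₇ 10 (by norm_num)).trans u10
  refine .of_loopFree rfl (by decide) ⟨?_, ?_, ?_, ?_, ?_, ?_⟩
  · simp [block, result, hc₆.one, x8]
    omega
  · simp [block, result, regFrame_update_iff, hr.trans f₈ (by norm_num)]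
  · simp [block, result, hc₆.modulus, x9]
    ring
  · simp [block, result, x10]
  · intro m h0 hm
    have := hw₆ m h0 hm
    simp [block, result, this, weight_succ, W, hg]
  · intro x
    have := hf₆ x
    simp [block, result, this, hQ]

/-! ### Initialization -/

/-- Add to `r₈` the rounded up binary logarithm of `rᵢ`. -/
def logLoop (i : ℕ) : Prog := loop 10 (block [add 9 9 9, add 8 8 3, sub 10 i 9])

theorem runs_logLoop {i n v : ℕ} {σ : Memory} (hi : i < 8) (hσ : σ i = n) (h3 : σ 3 = 1)
    (h8 : σ 8 = v) (h9 : σ 9 = 1) (h10 : σ 10 = n - 1) :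
    Runs (logLoop i) σ (Nat.clog 2 n * (10 + 1) + 1)
      (fun σ' => σ' = Function.update (Function.update (Function.update σ 8 (v + Nat.clog 2 n))
        9 (2 ^ Nat.clog 2 n)) 10 0) := by
  -- `r₉` doubles until it reaches `n`, which takes `Nat.clog 2 n` rounds.
  refine (Runs.loop (fun k σ' => σ' = Function.update (Function.update (Function.update σ 8 (v + k))
    9 (2 ^ k)) 10 (n - 2 ^ k)) ?_ ?_ ?_).mono le_rfl fun σ' h => ?_
  · rintro k hk τ rfl
    have := Nat.pow_lt_of_lt_clog hk
    refine ⟨by simp; omega, .of_loopFree rfl (by simp [cost, block]) ?_⟩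
    have i8 : i ≠ 8 := by omega
    have i9 : i ≠ 9 := by omega
    have i10 : i ≠ 10 := by omega
    simp only [block, result]
    funext a
    simp [Function.update_apply, h3, hσ, i8, i9, i10, pow_succ, mul_two, add_assoc]
    grind
  · rintro τ rfl
    simp [Nat.le_pow_clog]
  · funext a
    simp [Function.update_apply]
    grind
  · rw [h]
    simp [Nat.le_pow_clog]

/-- Add to `rᵢ` the product of `r₁₀` and `r₁₃`. -/
def mulLoop (i : ℕ) : Prog := loop 10 (block [add i i 13, sub 10 10 3])

theorem runs_mulLoop {i n q : ℕ} {σ : Memory} (hi : i < 8) (hi3 : i ≠ 3) (h3 : σ 3 = 1)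
    (h10 : σ 10 = n) (h13 : σ 13 = q) :
    Runs (mulLoop i) σ (n * (10 + 1) + 1)
      (fun σ' => σ' = Function.update (Function.update σ i (σ i + n * q)) 10 0) := by
  refine (Runs.count (fun k σ' => σ' = Function.update (Function.update σ i (σ i + k * q))
    10 (n - k)) ?_ h10 ?_).mono le_rfl fun σ' h => ?_
  · rintro k hk τ - rfl
    have i13 : i ≠ 13 := by omega
    have i10 : i ≠ 10 := by omega
    refine .of_loopFree rfl (by simp [cost, block]) ⟨?_, ?_⟩
    · simp [block, result, Function.update_apply, h3, hi3.symm, i10.symm]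
      omega
    · simp only [block, result]
      funext a
      simp [Function.update_apply, h3, h13, hi3.symm, i10, i10.symm, i13.symm]
      grind
  · funext a
    simp [Function.update_apply]
    grind
  · rw [h, Nat.sub_self]

/-- Initialize the weights. -/
def fillLoop : Prog := loop 20 (block [add 19 19 3, store 19 3, sub 20 20 3])

theorem runs_fillLoop {N : ℕ} {σ : Memory} (h3 : σ 3 = 1) (h19 : σ 19 = 32) (h20 : σ 20 = N - 1)
    (hf : StoresEntries N (fun _ => 0) σ) :
    Runs fillLoop σ ((N - 1) * (10 + 1) + 1) (fun σ' => RegFrame 19 σ σ' ∧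
      StoresWeights N (fun _ => 1) σ' ∧ StoresEntries N (fun _ => 0) σ') := by
  refine (Runs.count (fun k σ' => RegFrame 19 σ σ' ∧ σ' 19 = k + 32 ∧
    (∀ m, 0 < m → m ≤ k → σ' (m + 32) = 1) ∧ StoresEntries N (fun _ => 0) σ') ?_ h20
    ⟨.refl _ _, by simpa, fun m h0 hm => by omega, hf⟩).mono le_rfl
    fun σ' h => ⟨h.1, fun m h0 hm => h.2.2.1 m h0 (by omega), h.2.2.2⟩
  rintro k hk τ hτ ⟨hr, h19, hw, hf⟩
  have t3 := (hr 3 (by norm_num)).trans h3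
  have hk1 : k + 32 + 1 = k + 1 + 32 := by ring
  refine .of_loopFree rfl (by decide) ⟨?_, ?_, ?_, ?_, ?_⟩
  · simp [block, result, t3, h19, hτ, hk1]
    omega
  · have : 19 ≤ k + 1 + 32 := by omega
    simp [block, result, t3, h19, hk1, regFrame_update_iff, hr, this]
  · simp [block, result, t3, h19, hk1]
  · intro m h0 hm
    by_cases hmk : m = k + 1
    · simp [block, result, t3, h19, hk1, hmk]
    · have := hw m h0 (by omega)
      simp [block, result, t3, h19, hk1, hmk, this]
  · intro x
    have hx : x + N ≠ k + 1 := by omega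
    have := hf x
    simp [block, result, t3, h19, hk1, hx, this]

/-- The state of the registers during the initialization. -/
structure Setup (N c q s₅ s₈ : ℕ) (σ : Memory) : Prop where
  cols : σ 1 = N
  accuracy : σ 2 = c
  one : σ 3 = 1
  modulus : σ 5 = s₅
  zero : σ 7 = 0
  counter : σ 8 = s₈
  labels : σ 13 = q
  entries : ∀ a, σ (a + 32) = 0

/-- The program constructing almost disjunct matrices. -/
def construction : Prog :=
  block [block [const 3 1, add 13 0 0, add 13 13 13, add 13 13 13, add 13 13 13, add 13 13 13,
      add 13 13 13, const 9 1, sub 10 1 9],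
    logLoop 1, block [const 9 1, sub 10 2 9], logLoop 2, block [add 8 8 8, add 10 1 7], mulLoop 5,
    block [const 0 0, add 10 8 7], mulLoop 0,
    block [const 6 32, add 2 6 1, add 4 1 1, add 19 6 7, sub 20 1 3], fillLoop,
    block [add 9 2 7, sub 10 1 3], mainLoop]

/-- A bound for the number of steps of the program. -/
def constructionTime (N q v : ℕ) : ℕ := 33 * v + 22 * N + 2 * v * (roundTime N q + 1) + 100

theorem runs_construction {t N c v : ℕ} (ht : 0 < t) (hN : 0 < N)
    (hv : v = Nat.clog 2 N + Nat.clog 2 c) :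
    Runs construction (inputMemory t N c) (constructionTime N (64 * t) v)
      (fun σ' => σ' 0 = 2 * v * (64 * t) ∧ σ' 1 = N ∧ σ' 2 = N + 32 ∧
        StoresEntries N (partialEntry N (64 * t * N) (2 * v) 0) σ') := by
  set q := 64 * t with hq
  refine Runs.mono (T := 20 + ((Nat.clog 2 N * (10 + 1) + 1) + (10 + ((Nat.clog 2 c * (10 + 1) + 1) +
    (10 + ((N * (10 + 1) + 1) + (10 + ((2 * v * (10 + 1) + 1) + (10 + (((N - 1) * (10 + 1) + 1) +
    (10 + ((2 * v * (roundTime N q + 1) + 1) + 1))))))))))))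
    ?_ (by unfold constructionTime; omega) fun _ h => h
  refine .step rfl (by decide) ?_
  generalize hτ₁ : result _ (inputMemory t N c) = τ₁
  -- Six doublings of `t` put `q = 64 * t` into `r₁₃`.
  have s₁ : Setup N c q 0 0 τ₁ := by
    subst hτ₁
    constructor <;> simp [block, result, inputMemory]
    omega
  have s₁' : τ₁ 9 = 1 ∧ τ₁ 10 = N - 1 := by
    subst hτ₁
    constructor <;> simp [block, result, inputMemory]
  refine (runs_logLoop (by norm_num) s₁.cols s₁.one s₁.counter s₁'.1 s₁'.2).seq ?_
  rintro _ rfl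
  refine .step rfl (by decide) ?_
  generalize hτ₂ : result _ _ = τ₂
  have s₂ : Setup N c q 0 (Nat.clog 2 N) τ₂ := by
    subst hτ₂
    constructor <;> simp [block, result, s₁.1, s₁.2, s₁.3, s₁.4, s₁.5, s₁.7, s₁.8]
  have s₂' : τ₂ 9 = 1 ∧ τ₂ 10 = c - 1 := by
    subst hτ₂
    constructor <;> simp [block, result, s₁.2]
  refine (runs_logLoop (by norm_num) s₂.accuracy s₂.one s₂.counter s₂'.1 s₂'.2).seq ?_
  rintro _ rfl
  refine .step rfl (by decide) ?_
  generalize hτ₃ : result _ _ = τ₃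
  have s₃ : Setup N c q 0 (2 * v) τ₃ := by
    subst hτ₃
    constructor <;> simp [block, result, s₂.1, s₂.2, s₂.3, s₂.4, s₂.5, s₂.7, s₂.8]
    omega
  have s₃' : τ₃ 10 = N := by
    subst hτ₃
    simp [block, result, s₂.1, s₂.5]
  refine (runs_mulLoop (by norm_num) (by norm_num) s₃.one s₃' s₃.labels).seq ?_
  rintro _ rfl
  refine .step rfl (by decide) ?_
  generalize hτ₄ : result _ _ = τ₄
  have s₄ : Setup N c q (q * N) (2 * v) τ₄ := by
    subst hτ₄
    constructor <;> simp [block, result, s₃.1, s₃.2, s₃.3, s₃.4, s₃.5, s₃.6, s₃.7, s₃.8, mul_comm]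
  have s₄' : τ₄ 0 = 0 ∧ τ₄ 10 = 2 * v := by
    subst hτ₄
    constructor <;> simp [block, result, s₃.5, s₃.6]
  refine (runs_mulLoop (by norm_num) (by norm_num) s₄.one s₄'.2 s₄.labels).seq ?_
  rintro _ rfl
  refine .step rfl (by decide) ?_
  generalize hτ₅ : result _ _ = τ₅
  have c₅ : Consts (2 * v * q) N (q * N) τ₅ := by
    subst hτ₅
    constructor <;> simp [block, result, s₄.1, s₄.3, s₄.4, s₄.5, s₄'.1]
    · omega
    · omega
  have s₅ : τ₅ 8 = 2 * v ∧ τ₅ 19 = 32 ∧ τ₅ 20 = N - 1 := by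
    subst hτ₅
    refine ⟨?_, ?_, ?_⟩ <;> simp [block, result, s₄.1, s₄.3, s₄.5, s₄.6]
  have e₅ : StoresEntries N (fun _ => 0) τ₅ := by
    subst hτ₅
    intro x
    simp [block, result, s₄.8]
  refine (runs_fillLoop c₅.one s₅.2.1 s₅.2.2 e₅).seq ?_
  rintro τ₆ ⟨f₆, w₆, e₆⟩
  have c₆ := c₅.of_regFrame f₆ (by norm_num)
  have x8 := (f₆ 8 (by norm_num)).trans s₅.1
  refine .step rfl (by decide) ?_
  generalize hτ₇ : result _ _ = τ₇
  have f₇ : Frame 9 τ₆ τ₇ := by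
    subst hτ₇
    simp [block, result, frame_update_iff, Frame.refl]
  have s₇ : τ₇ 9 = N + 32 ∧ τ₇ 10 = N - 1 := by
    subst hτ₇
    constructor <;> simp [block, result, c₆.2, c₆.3, c₆.4, c₆.8]
  have c₇ := c₆.of_regFrame f₇.regFrame (by norm_num)
  refine (runs_mainLoop c₇ hN (by omega) ((f₇ 8 (by norm_num)).trans x8) s₇.1 s₇.2
    (w₆.of_frame f₇) (e₆.of_frame f₇)).seq ?_
  rintro τ₈ ⟨f₈, e₈⟩
  have c₈ := c₇.of_regFrame f₈ le_rfl
  exact .of_loopFree rfl le_rfl ⟨c₈.rows, c₈.cols, c₈.base, e₈⟩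

/-! ### The output matrix, its size and the running time -/

theorem presents_labelMatrix {N q w : ℕ} {σ : Memory} (h0 : σ 0 = w * q) (h1 : σ 1 = N)
    (h2 : σ 2 = N + 32) (h : StoresEntries N (partialEntry N (q * N) w 0) σ) :
    Presents σ (labelMatrix (greedyLabel N (q * N)) w q) := by
  refine ⟨h0, h1, fun r j => ?_⟩
  have hN : 0 < N := (Nat.zero_le _).trans_lt j.2
  have hlt : (r : ℕ) * N + j < w * (q * N) := by
    calc (r : ℕ) * N + j < r * N + N := by omega
      _ = (r + 1) * N := by ring
      _ ≤ w * q * N := Nat.mul_le_mul_right _ r.2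
      _ = w * (q * N) := by ring
  have hmod : ((r : ℕ) * N + j) % N = j := by
    rw [Nat.mul_add_mod', Nat.mod_eq_of_lt j.2]
  have hdiv : ((r : ℕ) * N + j) / N = r := by
    rw [mul_comm, Nat.mul_add_div hN, Nat.div_eq_of_lt j.2, add_zero]
  have hdiv' : ((r : ℕ) * N + j) / (q * N) = r / q := by
    rw [mul_comm q, ← Nat.div_div_eq_div_mul, hdiv]
  have hmod' : ((r : ℕ) * N + j) % (q * N) / N = r % q := by
    rw [mul_comm q, Nat.mod_mul_right_div_self, hdiv]
  have := h (r * N + j)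
  rw [partialEntry, if_pos (Or.inl hlt), entry, hmod, hdiv', hmod'] at this
  rw [h2, show N + 32 + ((r : ℕ) * N + j) = r * N + j + N + 32 by ring, this]
  exact if_congr decide_eq_true_iff.symm rfl rfl

/-- Rounding up costs at most 1: `2 ^ (Nat.clog 2 n - 1) < n` unless the logarithm is 0. -/
theorem cast_clog_two_le {n : ℕ} {x : ℝ} (hn : 0 < n) (h : (n : ℝ) ≤ x) :
    (Nat.clog 2 n : ℝ) * Real.log 2 ≤ Real.log x + Real.log 2 := by
  have hx : (1 : ℝ) ≤ x := le_trans (by exact_mod_cast hn) h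
  have hl : 0 < Real.log 2 := Real.log_pos (by norm_num)
  rcases Nat.eq_zero_or_pos (Nat.clog 2 n) with h0 | h0
  · rw [h0, Nat.cast_zero, zero_mul]
    linarith [Real.log_nonneg hx]
  · obtain ⟨k, hk⟩ := Nat.exists_eq_succ_of_ne_zero h0.ne'
    have h1 : 2 ^ k < n := Nat.pow_lt_of_lt_clog (by omega)
    have h2 : (2 : ℝ) ^ k ≤ x := le_trans (by exact_mod_cast h1.le) h
    have h3 := Real.log_le_log (by positivity) h2
    rw [Real.log_pow] at h3
    rw [hk]
    push_cast
    linarith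

theorem mul_le_const_mul {t N v : ℕ} {ε : ℝ} (ht : 2 ≤ t) (htN : t ≤ N) (hε : 0 < ε) (hε1 : ε ≤ 1)
    (hv : v = Nat.clog 2 N + Nat.clog 2 ⌈1 / ε⌉₊) :
    ((2 * v * (64 * t) : ℕ) : ℝ) ≤
      1024 * ((t : ℝ) / Real.log t * Real.log N * Real.log (N / ε)) := by
  have ht' : (2 : ℝ) ≤ t := by exact_mod_cast ht
  have htN' : (t : ℝ) ≤ N := by exact_mod_cast htN
  have hNpos : (0 : ℝ) < N := by linarith
  have hl2 : 0.6931471803 < Real.log 2 := Real.log_two_gt_d9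
  have hlt : 0 < Real.log t := Real.log_pos (by linarith)
  have hltN : Real.log t ≤ Real.log N := Real.log_le_log (by linarith) htN'
  have hinv : 1 ≤ 1 / ε := (one_le_div hε).2 hε1
  have hceil : (⌈1 / ε⌉₊ : ℝ) ≤ 2 / ε := by
    have := (Nat.ceil_lt_add_one (by positivity : 0 ≤ 1 / ε)).le
    have e : 2 / ε = 1 / ε + 1 / ε := by ring
    linarith
  have hcpos : 0 < ⌈1 / ε⌉₊ := Nat.ceil_pos.2 (by positivity)
  have c1 := cast_clog_two_le (by omega : 0 < N) le_rfl
  have c2 := cast_clog_two_le hcpos hceil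
  have hlog : Real.log (N / ε) = Real.log N - Real.log ε := Real.log_div hNpos.ne' hε.ne'
  have hlog2 : Real.log (2 / ε) = Real.log 2 - Real.log ε := Real.log_div (by norm_num) hε.ne'
  have hL : Real.log 2 ≤ Real.log (N / ε) := by
    refine Real.log_le_log (by norm_num) ?_
    rw [le_div_iff₀ hε]
    nlinarith
  -- The two roundings and `⌈1 / ε⌉ ≤ 2 / ε` cost `3 * log 2`, which `N / ε ≥ 2` absorbs; the factor
  -- 4 becomes 8 because `log 2 > 1 / 2`.
  have hvL : (v : ℝ) ≤ 8 * Real.log (N / ε) := by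
    have h1 : (v : ℝ) * Real.log 2 ≤ 4 * Real.log (N / ε) := by
      rw [hv]
      push_cast
      linarith
    nlinarith
  have hL0 : 0 ≤ Real.log (N / ε) := by linarith
  -- Only here is the bound weakened to the stated form, by the factor `log N / log t ≥ 1`.
  have hratio : (t : ℝ) ≤ t / Real.log t * Real.log N := by
    rw [div_mul_eq_mul_div, le_div_iff₀ hlt]
    exact mul_le_mul_of_nonneg_left hltN (by linarith)
  push_cast
  calc (2 : ℝ) * v * (64 * t) = 128 * (t * v) := by ring
    _ ≤ 128 * (t * (8 * Real.log (N / ε))) := by gcongr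
    _ = 1024 * (t * Real.log (N / ε)) := by ring
    _ ≤ _ := by gcongr

theorem le_mul_two_pow {N v : ℕ} {ε : ℝ} (hε : 0 < ε)
    (hv : v = Nat.clog 2 N + Nat.clog 2 ⌈1 / ε⌉₊) : (N : ℝ) ≤ ε * 2 ^ v := by
  have h1 : (N : ℝ) ≤ 2 ^ Nat.clog 2 N := by exact_mod_cast Nat.le_pow_clog (by norm_num) N
  have h2 : (⌈1 / ε⌉₊ : ℝ) ≤ 2 ^ Nat.clog 2 ⌈1 / ε⌉₊ := by
    exact_mod_cast Nat.le_pow_clog (by norm_num) ⌈1 / ε⌉₊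
  have h3 : 1 ≤ ε * 2 ^ Nat.clog 2 ⌈1 / ε⌉₊ := by
    have := (Nat.le_ceil (1 / ε)).trans h2
    rwa [div_le_iff₀' hε] at this
  calc (N : ℝ) = N * 1 := (mul_one _).symm
    _ ≤ 2 ^ Nat.clog 2 N * (ε * 2 ^ Nat.clog 2 ⌈1 / ε⌉₊) := by gcongr
    _ = _ := by rw [hv, pow_add]; ring

/-- Each of `t`, `N` and `v` is at most `N + Nat.size c`, so the polynomial is the time bound with
this one variable in their place. -/
theorem exists_polynomial_constructionTime_le :
    ∃ p : Polynomial ℕ, ∀ t N c v : ℕ, t ≤ N → v = Nat.clog 2 N + Nat.clog 2 c →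
      constructionTime N (64 * t) v ≤ p.eval (N + Nat.size c) := by
  let X : Polynomial ℕ := Polynomial.X
  refine ⟨33 * X + 22 * X + 2 * X *
    ((64 * X * X * (31 * X + 101) + 31 * X + X * (11 * (64 * X) + 101) + 60) + 1) + 100,
    fun t N c v htN hv => ?_⟩
  have hN : N ≤ N + Nat.size c := by omega
  have hN1 : Nat.clog 2 N ≤ N := Nat.clog_le_of_le_pow Nat.lt_two_pow_self.le
  have hc : Nat.clog 2 c ≤ Nat.size c := Nat.clog_le_of_le_pow (Nat.lt_size_self c).le
  have hvx : v ≤ N + Nat.size c := by omega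
  have htx : t ≤ N + Nat.size c := by omega
  simp only [X, Polynomial.eval_add, Polynomial.eval_mul, Polynomial.eval_X,
    Polynomial.eval_ofNat, Polynomial.eval_one, constructionTime, roundTime]
  generalize N + Nat.size c = x at *
  gcongr

/-! ### Decoding -/

/-- **Disjunct decoding**: if no item outside `S` has its tests covered by those of `S`, then
discarding the items in negative tests leaves exactly `S`. -/
theorem decode_testResult {M N : ℕ} {A : Matrix (Fin M) (Fin N) Bool} {S : Finset (Fin N)}
    (h : ∀ ν, ν ∉ S → ¬ support A ν ⊆ S.biUnion (support A)) : decode A (testResult A S) = S := by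
  ext j
  rw [decode, mem_filter]
  simp only [testResult, mem_univ, true_and, decide_eq_false_iff_not, not_exists, not_and,
    Bool.not_eq_true]
  refine ⟨fun hj => ?_, fun hj i hi => hi j hj⟩
  by_contra hjS
  refine h j hjS fun i hi => ?_
  by_contra hcon
  simp only [support, mem_biUnion, mem_filter, mem_univ, true_and, not_exists, not_and,
    Bool.not_eq_true] at hi hcon
  rw [hj i hcon] at hi
  exact Bool.noConfusion hi

theorem ofReal_le_prob_decode {M N t : ℕ} {ε : ℝ} {A : Matrix (Fin M) (Fin N) Bool} (h : t ≤ N)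
    (hA : IsAlmostDisjunct A t ε) :
    ENNReal.ofReal (1 - ε) ≤
      (uniformDefectives N t h).toOuterMeasure {S | decode A (testResult A S) = S} := by
  classical
  obtain ⟨B, hB, hcard, hdisj⟩ := hA
  rw [uniformDefectives, PMF.toOuterMeasure_uniformOfFinset_apply, card_powersetCard, card_univ,
    Fintype.card_fin]
  have hpos : 0 < N.choose t := Nat.choose_pos h
  rw [ENNReal.le_div_iff_mul_le (Or.inl (by exact_mod_cast hpos.ne'))
    (Or.inl (ENNReal.natCast_ne_top _))]
  have hsub : B ⊆ {S ∈ powersetCard t (univ : Finset (Fin N)) |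
      S ∈ {S | decode A (testResult A S) = S}} :=
    fun S hS => mem_filter.2 ⟨hB hS, decode_testResult (hdisj S hS)⟩
  refine le_trans ?_ (le_of_le_of_eq (Nat.cast_le.2 (card_le_card hsub)) (by congr!))
  calc ENNReal.ofReal (1 - ε) * N.choose t = ENNReal.ofReal ((1 - ε) * N.choose t) := by
        rw [ENNReal.ofReal_mul' (Nat.cast_nonneg _), ENNReal.ofReal_natCast]
    _ ≤ ENNReal.ofReal (#B : ℝ) := ENNReal.ofReal_le_ofReal hcard
    _ = (#B : ENNReal) := ENNReal.ofReal_natCast _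

end GroupTesting

theorem theorem2 :
    -- One deterministic program `P` constructs the matrices, for all `t`, `N`, `ε`, in time
    -- polynomial in `N` and in the number of bits of `⌈1 / ε⌉`.
    (∃ (P : GroupTesting.Prog) (p : Polynomial ℕ) (C : ℝ),
      ∀ (t N : ℕ) (ε : ℝ), 2 ≤ t → t ≤ N → 0 < ε → ε ≤ 1 →
        ∃ (T : ℕ) (σ : GroupTesting.Memory) (M : ℕ) (A : Matrix (Fin M) (Fin N) Bool),
          GroupTesting.Exec P (GroupTesting.inputMemory t N ⌈1 / ε⌉₊) T σ ∧
          T ≤ p.eval (N + Nat.size ⌈1 / ε⌉₊) ∧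
          GroupTesting.Presents σ A ∧
          GroupTesting.IsAlmostDisjunct A t ε ∧
          (M : ℝ) ≤ C * ((t : ℝ) / Real.log t * Real.log N * Real.log (N / ε))) ∧
    -- A `(t, ε)`-disjunct matrix identifies a uniformly random `t`-set of defectives from the test
    -- results with probability at least `1 - ε`.
    (∀ (M N t : ℕ) (ε : ℝ) (A : Matrix (Fin M) (Fin N) Bool) (h : t ≤ N), 0 < ε →
      GroupTesting.IsAlmostDisjunct A t ε →
        ENNReal.ofReal (1 - ε) ≤
          (GroupTesting.uniformDefectives N t h).toOuterMeasure
            {S | GroupTesting.decode A (GroupTesting.testResult A S) = S}) := by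
  refine ⟨?_, fun M N t ε A h _ hA => GroupTesting.ofReal_le_prob_decode h hA⟩
  obtain ⟨p, hp⟩ := GroupTesting.exists_polynomial_constructionTime_le
  refine ⟨GroupTesting.construction, p, 1024, fun t N ε ht htN hε hε1 => ?_⟩
  obtain ⟨v, hv⟩ : ∃ v, v = Nat.clog 2 N + Nat.clog 2 ⌈1 / ε⌉₊ := ⟨_, rfl⟩
  obtain ⟨T, σ, hexec, hT, h0, h1, h2, h⟩ :=
    GroupTesting.runs_construction (t := t) (by omega) (by omega) hv
  exact ⟨T, σ, 2 * v * (64 * t), _, hexec, hT.trans (hp t N _ v htN hv),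
    GroupTesting.presents_labelMatrix h0 h1 h2 h,
    GroupTesting.isAlmostDisjunct_greedy (by omega) (GroupTesting.le_mul_two_pow hε hv),
    GroupTesting.mul_le_const_mul ht htN hε hε1 hv⟩
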